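/- Let $\mu,\lambda,\sigma,r,p,\varphi_0\in\mathbb{R}$ with $\sigma\neq0$, $p\neq0$, let $N\ge 0$ and let $k_1,\dots,k_N,\eta_{1,0},\dots,\eta_{N,0}\in\mathbb{C}$. Put $$\mu_j=1,\quad w_j=k_j,\quad \eta_j=k_jx+\frac{\mu+\lambda}{k_j}t+\eta_{j,0}\qquad(1\le j\le N),$$ $$\mu_{N+j}=-1,\quad w_{N+j}=k_j^*,\quad \eta_{N+j}=\eta_j^*\qquad(1\le j\le N),$$ and $\varphi=px-\frac{\mu+\lambda}{p}t+\varphi_0$. Assume that all denominators below are nonzero, i.e. $k_j\ne0$, $p^2+k_j^2\neq0$, $k_j+k_l\ne0$ for $j\neq l$, and for all $j,l$: $k_j^2\neq (k_l^*)^2$ and $\frac2\sigma+\frac{4p^2r^2}{(p^2+k_j^2)(p^2+k_l^{*2})}\neq0$. (In particular no $k_j$ is real or purely imaginary.) Define the Pfaffians $$f=(\bullet),\qquad g_1=(d_0,\beta,\bullet),\qquad g_2=re^{i\varphi}(d_0,\gamma,\bullet),\qquad (\bullet)=(a_1,\dots,a_{2N},b_{2N},\dots,b_1),$$ with the antisymmetric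 entries $$(a_j,a_l)=\frac{w_l-w_j}{w_l+w_j}e^{\eta_j+\eta_l},\qquad (a_j,b_l)=\delta_{jl},\qquad (b_j,b_l)=\frac{1-\mu_j\mu_l}{2(w_j^2-w_l^2)\left(\frac2\sigma+\frac{4p^2r^2}{(p^2+w_j^2)(p^2+w_l^2)}\right)},$$ where $(b_j,b_l)=0$ if $\mu_j=\mu_l$, $$(b_j,\beta)=\frac{1+\mu_j}2,\quad (a_j,\beta)=0,\quad (a_j,\gamma)=\frac{2ip}{w_j+ip}e^{\eta_j},\quad (b_j,\gamma)=0,$$ $$(d_l,a_j)=w_j^le^{\eta_j},\quad (d_l,b_j)=(d_l,d_j)=(d_l,\beta)=0,\quad (d_l,\gamma)=\delta_{0l}.$$ A Pfaffian is given by $(i_1,\dots,i_{2m})=\sum_{j=2}^{2m}(-1)^j(i_1,i_j)(i_2,\dots,\widehat{i_j},\dots,i_{2m})$, the empty Pfaffian being $1$; so $g_1,g_2$ involve Pfaffians of order $2N+1$ ($4N+2$ labels). Then: (1) $f,g_1,g_2$ are smooth functions of $(x,t)\in\mathbb{R}^2$, $f$ is real-valued, and on all of $\mathbb{R}^2$ $$D_xD_t\,g_1\cdot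 f=(\mu+\lambda)g_1f,\qquad D_xD_t\,g_2\cdot f=(\mu+\lambda)g_2f,\qquad (D_x^2+r^2\sigma)f\cdot f=\sigma\left(|g_1|^2+|g_2|^2\right),$$ where $D_x^nD_t^m F\cdot G=\partial_\epsilon^n\partial_\delta^m\big(F(x+\epsilon,t+\delta)G(x-\epsilon,t-\delta)\big)\big|_{\epsilon=\delta=0}$. (2) On the open set $\{f\ne0\}$ the functions $A_1=g_1/f$, $A_2=g_2/f$, $B=2(\ln |f|)_{xt}-\lambda$ are smooth and solve the canonical two-component AB system $$A_{1,xt}=\mu A_1-A_1B,\qquad A_{2,xt}=\mu A_2-A_2B,\qquad B_x=\sigma\left(|A_1|^2+|A_2|^2\right)_t.$$ (3) If $c_1,c_2,n_1,n_2\in\mathbb{R}$ with $c_1\neq c_2$, $c_2\ne0$, $n_2\neq0$, $\mu=\frac{n_1c_2}{(c_1-c_2)^2}$ and $\sigma=\frac{n_2}{(c_1-c_2)^2}$, then $A_1$, $A_2$ and $B_0=\frac{(c_1-c_2)^2}{n_2c_2}B$, evaluated at $x=X-c_1T$, $t=T-X/c_2$, are smooth where $f\neq0$ and solve there the two-component AB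 system $$(\partial_T+c_1\partial_X)(\partial_T+c_2\partial_X)A_k=n_1A_k-n_2A_kB_0\quad(k=1,2),\qquad(\partial_T+c_2\partial_X)B_0=(\partial_T+c_1\partial_X)\left(|A_1|^2+|A_2|^2\right).$$ -/

import Mathlib

open scoped ContDiff ComplexConjugate

noncomputable section

namespace ABSystem

/-! ### Partial derivatives and the Hirota operator -/

/-- Partial derivative with respect to the first variable. -/
def dx {E : Type*} [NormedAddCommGroup E] [NormedSpace ℝ E] (F : ℝ → ℝ → E) (x t : ℝ) : E :=
  deriv (fun s => F s t) x

/-- Partial derivative with respect to the second variable. -/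
def dt {E : Type*} [NormedAddCommGroup E] [NormedSpace ℝ E] (F : ℝ → ℝ → E) (x t : ℝ) : E :=
  deriv (fun s => F x s) t

/-- The Hirota operator: `hirota n m f g x t` is `(D_x^n D_t^m f · g)(x, t)`, that is,
`∂_ε^n ∂_δ^m (f (x + ε, t + δ) g (x - ε, t - δ))` at `ε = δ = 0`. -/
def hirota (n m : ℕ) (f g : ℝ → ℝ → ℂ) (x t : ℝ) : ℂ :=
  iteratedDeriv n
    (fun ε : ℝ => iteratedDeriv m (fun δ : ℝ => f (x + ε) (t + δ) * g (x - ε) (t - δ)) 0) 0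

/-! ### The two-component AB system -/

/-- `(A₁, A₂, B)` is a (smooth) solution on the open set `U` of the `(x, t)`-plane of the
canonical two-component AB system
`A_{k,xt} = μ A_k - A_k B` (`k = 1, 2`), `B_x = σ (|A₁|² + |A₂|²)_t`. -/
def IsCanonicalSolutionOn (μ σ : ℝ) (A₁ A₂ : ℝ → ℝ → ℂ) (B : ℝ → ℝ → ℝ)
    (U : Set (ℝ × ℝ)) : Prop :=
  IsOpen U ∧
  ContDiffOn ℝ ∞ (Function.uncurry A₁) U ∧
  ContDiffOn ℝ ∞ (Function.uncurry A₂) U ∧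
  ContDiffOn ℝ ∞ (Function.uncurry B) U ∧
  ∀ x t : ℝ, (x, t) ∈ U →
    dt (dx A₁) x t = μ * A₁ x t - A₁ x t * B x t ∧
    dt (dx A₂) x t = μ * A₂ x t - A₂ x t * B x t ∧
    dx B x t = σ * dt (fun x t => ‖A₁ x t‖ ^ 2 + ‖A₂ x t‖ ^ 2) x t

/-- The operator `∂_T + c ∂_X` acting on functions of `(X, T)`. -/
def transport {E : Type*} [NormedAddCommGroup E] [NormedSpace ℝ E] (c : ℝ) (F : ℝ → ℝ → E)
    (X T : ℝ) : E :=
  dt F X T + c • dx F X T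

/-- `(A₁, A₂, B₀)` is a (smooth) solution on the open set `U` of the `(X, T)`-plane of the
two-component AB system
`(∂_T + c₁ ∂_X) (∂_T + c₂ ∂_X) A_k = n₁ A_k - n₂ A_k B₀` (`k = 1, 2`),
`(∂_T + c₂ ∂_X) B₀ = (∂_T + c₁ ∂_X) (|A₁|² + |A₂|²)`. -/
def IsSolutionOn (c₁ c₂ n₁ n₂ : ℝ) (A₁ A₂ : ℝ → ℝ → ℂ) (B₀ : ℝ → ℝ → ℝ)
    (U : Set (ℝ × ℝ)) : Prop :=
  IsOpen U ∧
  ContDiffOn ℝ ∞ (Function.uncurry A₁) U ∧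
  ContDiffOn ℝ ∞ (Function.uncurry A₂) U ∧
  ContDiffOn ℝ ∞ (Function.uncurry B₀) U ∧
  ∀ X T : ℝ, (X, T) ∈ U →
    transport c₁ (transport c₂ A₁) X T = n₁ * A₁ X T - n₂ * A₁ X T * B₀ X T ∧
    transport c₁ (transport c₂ A₂) X T = n₁ * A₂ X T - n₂ * A₂ X T * B₀ X T ∧
    transport c₂ B₀ X T = transport c₁ (fun X T => ‖A₁ X T‖ ^ 2 + ‖A₂ X T‖ ^ 2) X T

/-! ### Pfaffians -/

/-- The Pfaffian `(i₁, i₂, …, iₘ)` with (antisymmetric) entries `(i, j) = e i j`, through its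
expansion along the first label,
`(i₁, …, iₘ) = ∑_{j ≥ 2} (-1)^j (i₁, i_j) (i₂, …, î_j, …, iₘ)`, and `1` for the empty list.
It is `0` if the number of labels is odd. -/
def pfaffian {ι : Type*} (e : ι → ι → ℂ) : List ι → ℂ
  | [] => 1
  | a :: l => ∑ i : Fin l.length, (-1) ^ (i : ℕ) * e a (l.get i) * pfaffian e (l.eraseIdx i)
termination_by l => l.length
decreasing_by
  have h := List.length_eraseIdx_le l (i : ℕ)
  simp only [List.length_cons]
  omega

/-! ### The Pfaffian tau functions -/

/-- The parameters of the `N`-bright-dark soliton solution (data only). -/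
structure Params (N : ℕ) where
  /-- coefficient of the canonical system -/
  μ : ℝ
  /-- coefficient of the canonical system -/
  σ : ℝ
  /-- the shift in `B = 2 (ln f)_{xt} - λ` -/
  lam : ℝ
  /-- background amplitude -/
  r : ℝ
  /-- background wave number -/
  p : ℝ
  /-- background phase constant -/
  φ₀ : ℝ
  /-- wave numbers `k_1, …, k_N` of the solitons -/
  k : Fin N → ℂ
  /-- phase constants `η_{1,0}, …, η_{N,0}` of the solitons -/
  η₀ : Fin N → ℂ

/-- The labels `d_l`, `β`, `γ`, `a_j`, `b_j` of the Pfaffians. -/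
inductive Label (n : ℕ) : Type
  | d (l : ℤ)
  | beta
  | gamma
  | a (j : Fin n)
  | b (j : Fin n)

namespace Params

variable {N : ℕ} (P : Params N)

/-- `w_j = k_j` for the first `N` indices and `w_{N+j} = k_j^*`. -/
def w : Fin (N + N) → ℂ :=
  Fin.append P.k (fun j => conj (P.k j))

/-- The signs `μ_j`: `1` for the first `N` indices, `-1` for the last `N`. -/
def sgn (N : ℕ) : Fin (N + N) → ℂ :=
  Fin.append (fun _ => 1) (fun _ => -1)

/-- The phases `η_j = k_j x + (μ + λ) / k_j t + η_{j,0}` for the first `N` indices, and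
`η_{N+j} = η_j^*`. -/
def η (x t : ℝ) : Fin (N + N) → ℂ :=
  Fin.append (fun j => P.k j * x + (P.μ + P.lam) / P.k j * t + P.η₀ j)
    (fun j => conj (P.k j * x + (P.μ + P.lam) / P.k j * t + P.η₀ j))

/-- The background phase `φ = p x - (μ + λ) / p t + φ₀`. -/
def φ (x t : ℝ) : ℝ :=
  P.p * x - (P.μ + P.lam) / P.p * t + P.φ₀

/-- `2 / σ + 4 p² r² / ((p² + u²) (p² + v²))`. -/
def coupling (u v : ℂ) : ℂ :=
  2 / P.σ + 4 * P.p ^ 2 * P.r ^ 2 / ((P.p ^ 2 + u ^ 2) * (P.p ^ 2 + v ^ 2))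

/-- The Pfaffian entries at the point `(x, t)`, extended antisymmetrically. The entries between
the labels `β`, `γ` do not occur and are set to `0`. -/
def entry (x t : ℝ) : Label (N + N) → Label (N + N) → ℂ
  | .a j, .a l => (P.w l - P.w j) / (P.w l + P.w j) * Complex.exp (P.η x t j + P.η x t l)
  | .a j, .b l => if j = l then 1 else 0
  | .b l, .a j => -(if j = l then 1 else 0)
  | .b j, .b l =>
      (1 - sgn N j * sgn N l) / (2 * (P.w j ^ 2 - P.w l ^ 2) * P.coupling (P.w j) (P.w l))
  | .b j, .beta => (1 + sgn N j) / 2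
  | .beta, .b j => -((1 + sgn N j) / 2)
  | .a _, .beta => 0
  | .beta, .a _ => 0
  | .a j, .gamma =>
      2 * Complex.I * P.p / (P.w j + Complex.I * P.p) * Complex.exp (P.η x t j)
  | .gamma, .a j =>
      -(2 * Complex.I * P.p / (P.w j + Complex.I * P.p) * Complex.exp (P.η x t j))
  | .b _, .gamma => 0
  | .gamma, .b _ => 0
  | .d l, .a j => P.w j ^ l * Complex.exp (P.η x t j)
  | .a j, .d l => -(P.w j ^ l * Complex.exp (P.η x t j))
  | .d _, .b _ => 0
  | .b _, .d _ => 0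
  | .d _, .d _ => 0
  | .d _, .beta => 0
  | .beta, .d _ => 0
  | .d l, .gamma => if l = 0 then 1 else 0
  | .gamma, .d l => -(if l = 0 then 1 else 0)
  | .beta, .beta => 0
  | .beta, .gamma => 0
  | .gamma, .beta => 0
  | .gamma, .gamma => 0

/-- The list of labels `(•) = (a_1, …, a_{2N}, b_{2N}, …, b_1)`. -/
def bullet (N : ℕ) : List (Label (N + N)) :=
  (List.finRange (N + N)).map Label.a ++ (List.finRange (N + N)).reverse.map Label.b

/-- `f = (•)`. -/
def f (x t : ℝ) : ℂ :=
  pfaffian (P.entry x t) (bullet N)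

/-- `g₁ = (d_0, β, •)`. -/
def g₁ (x t : ℝ) : ℂ :=
  pfaffian (P.entry x t) (.d 0 :: .beta :: bullet N)

/-- `g₂ = r e^{iφ} (d_0, γ, •)`. -/
def g₂ (x t : ℝ) : ℂ :=
  P.r * Complex.exp (Complex.I * P.φ x t) *
    pfaffian (P.entry x t) (.d 0 :: .gamma :: bullet N)

/-- `A₁ = g₁ / f`. -/
def A₁ (x t : ℝ) : ℂ := P.g₁ x t / P.f x t

/-- `A₂ = g₂ / f`. -/
def A₂ (x t : ℝ) : ℂ := P.g₂ x t / P.f x t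

/-- `B = 2 (ln f)_{xt} - λ`, for real `f`; here `ln f` is `ln |f|`, which does not change the
derivative where `f` is negative. -/
def B (x t : ℝ) : ℝ :=
  2 * dt (dx (fun x t => Real.log (P.f x t).re)) x t - P.lam

end Params

end ABSystem

end

/-! Let M(x,t) be the antisymmetric matrix of the entries between the labels of (•), and write ⟨u,v⟩
= uᵀM⁻¹v. Wherever det M ≠ 0, a Pfaffian (u,v,•) is f times a scalar built from the entry (u,v) and
a bracket (`pfaffian_cons_cons_bullet`). So f, g₁, g₂ and their derivatives all become f times
polynomials in brackets.

Differentiating e^{η_j+η_l} cancels the denominator w_j + w_l. Hence M_x and M_t have rank two and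
are built from the rows d_{-1}, d_0, d_1, so derivatives of brackets are again polynomials in
brackets (`hasDerivAt_pfaffian`, `hasDerivAt_bracket_of_rank_two`). The two D_xD_t equations are
then formal identities (`hirota_one_one_of_bracket`).

The D_x² equation carries the actual content. For a suitable diagonal h, the commutator (h_i -
h_j)M_ij is a short sum of products of d_0, d_1, d_2, β, γ and the conjugate columns. Evaluating it
on M⁻¹d_0 gives a quadratic relation between brackets (`bracket_quadratic`, `bracket_relation`).
Conjugation exchanges j and N+j, which makes f real and turns |g₁|² and |g₂|² into products of
brackets.

Points with det M = 0 are reached by continuity: a common real shift s of all η_{j,0} makes M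
invertible for all but finitely many s (`dense_setOf_det_ne_zero`). The AB systems then follow from
the quotient rule and a linear change of variables. -/

noncomputable section

namespace ABSystem

/-! ### Algebra of Pfaffians -/

section Pfaffian

variable {ι : Type*}

/-- The alternating sum `∑ᵢ (-1)ⁱ φ(lᵢ) F(l without its i-th term)`. -/
def expand (φ : ι → ℂ) (F : List ι → ℂ) (l : List ι) : ℂ :=
  ∑ i : Fin l.length, (-1) ^ (i : ℕ) * φ (l.get i) * F (l.eraseIdx i)

theorem pfaffian_nil (e : ι → ι → ℂ) : pfaffian e [] = 1 := by
  rw [pfaffian]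

theorem pfaffian_cons (e : ι → ι → ℂ) (a : ι) (l : List ι) :
    pfaffian e (a :: l) = expand (e a) (pfaffian e) l := by
  rw [pfaffian, expand]

theorem expand_nil (φ : ι → ℂ) (F : List ι → ℂ) : expand φ F [] = 0 := by
  simp [expand]

theorem expand_cons (φ : ι → ℂ) (F : List ι → ℂ) (y : ι) (l : List ι) :
    expand φ F (y :: l) = φ y * F l - expand φ (fun m => F (y :: m)) l := by
  unfold expand
  have h := Fin.sum_univ_succ (n := l.length)
    (fun i => (-1 : ℂ) ^ (i : ℕ) * φ ((y :: l).get i) * F ((y :: l).eraseIdx i))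
  refine h.trans ?_
  simp [pow_succ, Finset.sum_neg_distrib, sub_eq_add_neg]

theorem expand_sub (φ : ι → ℂ) (F G : List ι → ℂ) (l : List ι) :
    expand φ (fun m => F m - G m) l = expand φ F l - expand φ G l := by
  simp only [expand, ← Finset.sum_sub_distrib, mul_sub]

theorem expand_neg (φ : ι → ℂ) (F : List ι → ℂ) (l : List ι) :
    expand φ (fun m => -F m) l = -expand φ F l := by
  simp only [expand, ← Finset.sum_neg_distrib, mul_neg]

theorem expand_const_mul (φ : ι → ℂ) (F : List ι → ℂ) (c : ℂ) (l : List ι) :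
    expand φ (fun m => c * F m) l = c * expand φ F l := by
  simp only [expand, Finset.mul_sum]
  exact Finset.sum_congr rfl fun i _ => by ring

theorem expand_sum {κ : Type*} (s : Finset κ) (c : κ → ℂ) (φ : κ → ι → ℂ) (F : List ι → ℂ)
    (l : List ι) :
    expand (fun i => ∑ k ∈ s, c k * φ k i) F l = ∑ k ∈ s, c k * expand (φ k) F l := by
  simp only [expand, Finset.mul_sum, Finset.sum_mul]
  rw [Finset.sum_comm]
  exact Finset.sum_congr rfl fun i _ => Finset.sum_congr rfl fun i _ => by ring

theorem expand_congr {φ ψ : ι → ℂ} {F G : List ι → ℂ} {l : List ι} (h : ∀ i ∈ l, φ i = ψ i)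
    (hF : ∀ m, m.length < l.length → (∀ i ∈ m, i ∈ l) → F m = G m) :
    expand φ F l = expand ψ G l := by
  refine Finset.sum_congr rfl fun i _ => ?_
  rw [h _ (List.get_mem l i), hF]
  · have := List.length_eraseIdx_of_lt i.2
    have := i.2
    omega
  · exact fun j hj => List.mem_of_mem_eraseIdx hj

/-- Deleting two labels in the opposite order shifts one position by one, which changes the sign.
All antisymmetry of Pfaffians comes from this. -/
theorem expand_comm (φ ψ : ι → ℂ) (F : List ι → ℂ) (l : List ι) :
    expand φ (fun m => expand ψ F m) l = -expand ψ (fun m => expand φ F m) l := by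
  induction l generalizing F with
  | nil => simp [expand_nil]
  | cons y l ih =>
    simp only [expand_cons, expand_sub, expand_const_mul]
    rw [ih]
    ring

theorem pfaffian_swap_head {e : ι → ι → ℂ} (he : ∀ i j, e i j = -e j i) (a b : ι) (l : List ι) :
    pfaffian e (a :: b :: l) = -pfaffian e (b :: a :: l) := by
  simp only [pfaffian_cons, expand_cons]
  rw [expand_comm, he a b]
  ring

/-- The summands deleting x and y trade places with opposite sign; every other summand changes sign
by `hF`. The bound on m₁ lets `pfaffian_swap` supply `hF` by induction on the prefix length. -/
theorem expand_swap (φ : ι → ℂ) (x y : ι) (l₁ l₂ : List ι) (F : List ι → ℂ)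
    (hF : ∀ m₁ m₂ : List ι, m₁.length ≤ l₁.length →
      F (m₁ ++ x :: y :: m₂) = -F (m₁ ++ y :: x :: m₂)) :
    expand φ F (l₁ ++ x :: y :: l₂) = -expand φ F (l₁ ++ y :: x :: l₂) := by
  induction l₁ generalizing F with
  | nil =>
    have h : ∀ m₂, F (x :: y :: m₂) = -F (y :: x :: m₂) := fun m₂ => hF [] m₂ le_rfl
    simp only [List.nil_append, expand_cons, h, expand_neg]
    ring
  | cons z l₁ ih =>
    simp only [List.cons_append, expand_cons]
    rw [hF l₁ l₂ (by simp), ih (fun m => F (z :: m))]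
    · ring
    · intro m₁ m₂ hm
      simpa using hF (z :: m₁) m₂ (by simpa using hm)

theorem pfaffian_swap {e : ι → ι → ℂ} (he : ∀ i j, e i j = -e j i) (x y : ι) (l₁ l₂ : List ι) :
    pfaffian e (l₁ ++ x :: y :: l₂) = -pfaffian e (l₁ ++ y :: x :: l₂) := by
  suffices ∀ (n : ℕ) (l₁ l₂ : List ι), l₁.length ≤ n →
      pfaffian e (l₁ ++ x :: y :: l₂) = -pfaffian e (l₁ ++ y :: x :: l₂) from
    this _ l₁ l₂ le_rfl
  intro n
  induction n with
  | zero =>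
    intro l₁ l₂ h
    rw [List.length_eq_zero_iff.mp (Nat.le_zero.mp h)]
    exact pfaffian_swap_head he x y l₂
  | succ n ih =>
    intro l₁ l₂ h
    cases l₁ with
    | nil => exact pfaffian_swap_head he x y l₂
    | cons a l₁ =>
      simp only [List.cons_append, pfaffian_cons]
      refine expand_swap _ _ _ _ _ _ fun m₁ m₂ hm => ih m₁ m₂ ?_
      simp only [List.length_cons] at h
      omega

/-- Permuting the labels multiplies the Pfaffian by a sign that does not depend on the entries. -/
theorem exists_pfaffian_perm {l l' : List ι} (h : l.Perm l') :
    ∃ ε : ℂ, ∀ e : ι → ι → ℂ, (∀ i j, e i j = -e j i) → ∀ m,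
      pfaffian e (m ++ l) = ε * pfaffian e (m ++ l') := by
  induction h with
  | nil => exact ⟨1, by simp⟩
  | cons x _ ih =>
    obtain ⟨ε, h⟩ := ih
    refine ⟨ε, fun e he m => ?_⟩
    simpa using h e he (m ++ [x])
  | swap x y l => exact ⟨-1, fun e he m => by rw [pfaffian_swap he]; ring⟩
  | trans _ _ ih₁ ih₂ =>
    obtain ⟨ε₁, h₁⟩ := ih₁
    obtain ⟨ε₂, h₂⟩ := ih₂
    exact ⟨ε₁ * ε₂, fun e he m => by rw [h₁ e he, h₂ e he, mul_assoc]⟩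

/-- Up to a factor, the repeated label can be moved next to the first one; swapping the two equal
labels then gives P = -P. -/
theorem pfaffian_eq_zero_of_mem {e : ι → ι → ℂ} (he : ∀ i j, e i j = -e j i) {a : ι}
    {l : List ι} (h : a ∈ l) : pfaffian e (a :: l) = 0 := by
  classical
  obtain ⟨ε, hε⟩ := exists_pfaffian_perm (List.perm_cons_erase h)
  have h₁ := hε e he [a]
  have h₂ := pfaffian_swap_head he a a (l.erase a)
  simp only [List.singleton_append] at h₁
  rw [h₁, self_eq_neg.mp h₂, mul_zero]

/-- Elimination of a label `u` whose row is a combination of rows of the other labels. -/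
theorem pfaffian_eliminate {e : ι → ι → ℂ} (he : ∀ i j, e i j = -e j i) {κ : Type*} [Fintype κ]
    (lbl : κ → ι) (x : κ → ℂ) (u v : ι) (l : List ι) (hl : ∀ k, lbl k ∈ l)
    (hx : ∀ i ∈ l, e u i = ∑ k, x k * e (lbl k) i) :
    pfaffian e (u :: v :: l) = (e u v - ∑ k, x k * e (lbl k) v) * pfaffian e l := by
  -- The Pfaffian (lbl k, v, l) vanishes because lbl k recurs in l; its expansion along the first
  -- label gives this value.
  have h (k : κ) : expand (e (lbl k)) (fun m => pfaffian e (v :: m)) l =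
      e (lbl k) v * pfaffian e l := by
    have h := pfaffian_eq_zero_of_mem he (List.mem_cons_of_mem v (hl k))
    rw [pfaffian_cons, expand_cons] at h
    linear_combination -h
  rw [pfaffian_cons, expand_cons,
    expand_congr (ψ := fun i => ∑ k, x k * e (lbl k) i) hx (fun m _ _ => rfl), expand_sum]
  simp only [h, sub_mul, Finset.sum_mul, mul_assoc]

theorem pfaffian_map {κ : Type*} (e : ι → ι → ℂ) (g : κ → ι) (l : List κ) :
    pfaffian e (l.map g) = pfaffian (fun i j => e (g i) (g j)) l := by
  suffices ∀ (n : ℕ) (l : List κ), l.length ≤ n →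
      pfaffian e (l.map g) = pfaffian (fun i j => e (g i) (g j)) l from this _ l le_rfl
  intro n
  induction n with
  | zero =>
    intro l h
    rw [List.length_eq_zero_iff.mp (Nat.le_zero.mp h)]
    simp [pfaffian_nil]
  | succ n ih =>
    intro l h
    cases l with
    | nil => simp [pfaffian_nil]
    | cons a l =>
      have key : ∀ (φ : ι → ℂ) (F : List ι → ℂ) (l : List κ),
          expand φ F (l.map g) = expand (fun i => φ (g i)) (fun m => F (m.map g)) l := by
        intro φ F l
        induction l generalizing F with
        | nil => simp [expand_nil]
        | cons y l ih => simp [expand_cons, ih]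
      rw [List.map_cons, pfaffian_cons, pfaffian_cons, key]
      refine expand_congr (fun _ _ => rfl) fun m hm _ => ih m ?_
      simp only [List.length_cons] at h
      omega

theorem conj_pfaffian (e : ι → ι → ℂ) (l : List ι) :
    conj (pfaffian e l) = pfaffian (fun i j => conj (e i j)) l := by
  suffices ∀ (n : ℕ) (l : List ι), l.length ≤ n →
      conj (pfaffian e l) = pfaffian (fun i j => conj (e i j)) l from this _ l le_rfl
  intro n
  induction n with
  | zero =>
    intro l h
    rw [List.length_eq_zero_iff.mp (Nat.le_zero.mp h)]
    simp [pfaffian_nil]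
  | succ n ih =>
    intro l h
    cases l with
    | nil => simp [pfaffian_nil]
    | cons a l =>
      have key : conj (expand (e a) (pfaffian e) l) =
          expand (fun i => conj (e a i)) (fun m => conj (pfaffian e m)) l := by
        simp [expand]
      rw [pfaffian_cons, pfaffian_cons, key]
      refine expand_congr (fun _ _ => rfl) fun m hm _ => ih m ?_
      simp only [List.length_cons] at h
      omega

theorem contDiff_pfaffian {V : Type*} [NormedAddCommGroup V] [NormedSpace ℝ V]
    {n : WithTop ℕ∞} {e : V → ι → ι → ℂ} (he : ∀ i j, ContDiff ℝ n fun v => e v i j)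
    (l : List ι) : ContDiff ℝ n fun v => pfaffian (e v) l := by
  suffices ∀ (k : ℕ) (l : List ι), l.length ≤ k → ContDiff ℝ n fun v => pfaffian (e v) l from
    this _ l le_rfl
  intro k
  induction k with
  | zero =>
    intro l h
    rw [List.length_eq_zero_iff.mp (Nat.le_zero.mp h)]
    simpa only [pfaffian_nil] using contDiff_const
  | succ k ih =>
    intro l h
    cases l with
    | nil => simpa only [pfaffian_nil] using contDiff_const
    | cons a l =>
      simp only [pfaffian_cons, expand]
      refine ContDiff.sum fun i _ => (contDiff_const.mul (he _ _)).mul (ih _ ?_)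
      have := List.length_eraseIdx_of_lt i.2
      have := i.2
      simp only [List.length_cons] at h
      omega

/-- The derivative of a Pfaffian whose entries have a derivative of rank two. -/
theorem hasDerivAt_pfaffian {e : ℝ → ι → ι → ℂ} {s : ℝ} (he : ∀ i j, e s i j = -e s j i)
    (α β : ι) (c : ℂ) (l : List ι)
    (h : ∀ i ∈ l, ∀ j ∈ l, HasDerivAt (fun s => e s i j)
      (c * (e s α i * e s β j - e s β i * e s α j)) s) :
    HasDerivAt (fun s => pfaffian (e s) l)
      (c * (e s α β * pfaffian (e s) l - pfaffian (e s) (α :: β :: l))) s := by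
  suffices ∀ (n : ℕ) (l : List ι), l.length ≤ n →
      (∀ i ∈ l, ∀ j ∈ l, HasDerivAt (fun s => e s i j)
        (c * (e s α i * e s β j - e s β i * e s α j)) s) →
      HasDerivAt (fun s => pfaffian (e s) l)
        (c * (e s α β * pfaffian (e s) l - pfaffian (e s) (α :: β :: l))) s from
    this _ l le_rfl h
  intro n
  have hnil : HasDerivAt (fun s => pfaffian (e s) [])
      (c * (e s α β * pfaffian (e s) [] - pfaffian (e s) [α, β])) s := by
    simpa [pfaffian_nil, pfaffian_cons, expand_cons, expand_nil] using hasDerivAt_const s (1 : ℂ)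
  induction n with
  | zero =>
    intro l hl _
    rw [List.length_eq_zero_iff.mp (Nat.le_zero.mp hl)]
    exact hnil
  | succ n ih =>
    intro l hl h
    cases l with
    | nil => exact hnil
    | cons a l =>
      -- Product rule in the expansion along a: either the entry (a,i) is differentiated, or the
      -- smaller Pfaffian is, by induction.
      have h₁ : HasDerivAt (fun s => pfaffian (e s) (a :: l))
          (expand (fun i => c * (e s α a * e s β i - e s β a * e s α i)) (pfaffian (e s)) l +
            expand (e s a) (fun m => c * (e s α β * pfaffian (e s) m -
              pfaffian (e s) (α :: β :: m))) l) s := by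
        simp only [pfaffian_cons (e _) a, expand, ← Finset.sum_add_distrib]
        refine HasDerivAt.fun_sum fun i _ => ?_
        refine (((h a List.mem_cons_self _
          (List.mem_cons_of_mem _ (List.get_mem l i))).const_mul _).mul
          (ih (l.eraseIdx i) ?_ ?_)).congr_deriv ?_
        · have := List.length_eraseIdx_of_lt i.2
          have := i.2
          simp only [List.length_cons] at hl
          omega
        · exact fun j hj k hk => h j (List.mem_cons_of_mem _ (List.mem_of_mem_eraseIdx hj)) k
            (List.mem_cons_of_mem _ (List.mem_of_mem_eraseIdx hk))
        · simp only [pfaffian_cons, expand]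
      refine h₁.congr_deriv ?_
      have h₂ : expand (fun i => c * (e s α a * e s β i - e s β a * e s α i)) (pfaffian (e s)) l =
          c * (e s α a * pfaffian (e s) (β :: l) - e s β a * pfaffian (e s) (α :: l)) := by
        simp only [pfaffian_cons, expand, Finset.mul_sum, ← Finset.sum_sub_distrib]
        exact Finset.sum_congr rfl fun i _ => by ring
      -- Moving a across two labels costs no sign, and expanding along a then produces the same
      -- terms as the product rule.
      have h₃ : pfaffian (e s) (α :: β :: a :: l) = pfaffian (e s) (a :: α :: β :: l) := by
        have := pfaffian_swap he β a [α] l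
        simp only [List.singleton_append] at this
        rw [this, pfaffian_swap_head he α a, neg_neg]
      rw [h₂, h₃, expand_const_mul, expand_sub, expand_const_mul, ← pfaffian_cons,
        pfaffian_cons (e s) a (α :: β :: l), expand_cons, expand_cons, he a α, he a β]
      ring

end Pfaffian

/-! ### The bilinear form of an inverse matrix -/

section Bracket

open Matrix

variable {I : Type*} [Fintype I] [DecidableEq I]

/-- The bilinear form of `M⁻¹`. -/
def bracket (M : Matrix I I ℂ) (u v : I → ℂ) : ℂ := u ⬝ᵥ (M⁻¹ *ᵥ v)

theorem bracket_add_right (M : Matrix I I ℂ) (u v v' : I → ℂ) :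
    bracket M u (v + v') = bracket M u v + bracket M u v' := by
  rw [bracket, mulVec_add, dotProduct_add]; rfl

theorem bracket_smul_left (M : Matrix I I ℂ) (c : ℂ) (u v : I → ℂ) :
    bracket M (c • u) v = c * bracket M u v := smul_dotProduct _ _ _

theorem bracket_smul_right (M : Matrix I I ℂ) (c : ℂ) (u v : I → ℂ) :
    bracket M u (c • v) = c * bracket M u v := by
  rw [bracket, mulVec_smul, dotProduct_smul]; rfl

theorem bracket_antisymm {M : Matrix I I ℂ} (hM : Mᵀ = -M) (u v : I → ℂ) :
    bracket M u v = -bracket M v u := by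
  have h : (M⁻¹)ᵀ = -M⁻¹ := by
    have h1 : (-M)⁻¹ = -M⁻¹ := by
      -- No invertibility is assumed: for singular M both inverses are the default value 0.
      by_cases hd : IsUnit M.det
      · refine Matrix.inv_eq_left_inv ?_
        rw [neg_mul_neg, Matrix.nonsing_inv_mul _ hd]
      · rw [nonsing_inv_apply_not_isUnit _ hd, nonsing_inv_apply_not_isUnit, neg_zero]
        rwa [← hM, det_transpose]
    rw [transpose_nonsing_inv, hM, h1]
  rw [bracket, bracket, dotProduct_mulVec, dotProduct_comm, ← mulVec_transpose, h, neg_mulVec,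
    dotProduct_neg]

theorem bracket_self {M : Matrix I I ℂ} (hM : Mᵀ = -M) (u : I → ℂ) : bracket M u u = 0 :=
  self_eq_neg.mp (bracket_antisymm hM u u)

theorem differentiableAt_det {M : ℝ → Matrix I I ℂ} {s : ℝ}
    (hM : ∀ i j, DifferentiableAt ℝ (fun s => M s i j) s) :
    DifferentiableAt ℝ (fun s => (M s).det) s := by
  simp only [det_apply]
  refine DifferentiableAt.fun_sum fun σ _ => DifferentiableAt.fun_const_smul ?_ _
  exact DifferentiableAt.fun_finsetProd fun i _ => hM _ _

/-- By Cramer's rule each entry of the inverse is a quotient of determinants. -/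
theorem differentiableAt_inv {M : ℝ → Matrix I I ℂ} {s : ℝ}
    (hM : ∀ i j, DifferentiableAt ℝ (fun s => M s i j) s) (hdet : (M s).det ≠ 0) (i j : I) :
    DifferentiableAt ℝ (fun s => (M s)⁻¹ i j) s := by
  have h : (fun s => (M s)⁻¹ i j) =
      fun s => (M s).det⁻¹ * ((M s).updateRow j (Pi.single i 1)).det := by
    funext s
    rw [inv_def, Matrix.smul_apply, Ring.inverse_eq_inv', adjugate_apply, smul_eq_mul]
  rw [h]
  refine ((differentiableAt_det hM).fun_inv hdet).mul (differentiableAt_det fun k l => ?_)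
  simp only [updateRow_apply]
  split_ifs
  · exact differentiableAt_const _
  · exact hM _ _

/-- The derivative of M⁻¹ is -M⁻¹M'M⁻¹, obtained by differentiating MM⁻¹ = 1, an identity valid near
s because det M ≠ 0 is an open condition. -/
theorem hasDerivAt_bracket {M : ℝ → Matrix I I ℂ} {M' : Matrix I I ℂ} {u v : ℝ → I → ℂ}
    {u' v' : I → ℂ} {s : ℝ} (hM : ∀ i j, HasDerivAt (fun s => M s i j) (M' i j) s)
    (hu : ∀ i, HasDerivAt (fun s => u s i) (u' i) s)
    (hv : ∀ i, HasDerivAt (fun s => v s i) (v' i) s) (hdet : (M s).det ≠ 0) :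
    HasDerivAt (fun s => bracket (M s) (u s) (v s))
      (bracket (M s) u' (v s) + bracket (M s) (u s) v' -
        bracket (M s) (u s) (M' *ᵥ ((M s)⁻¹ *ᵥ v s))) s := by
  have hd (i j) : DifferentiableAt ℝ (fun s => M s i j) s := (hM i j).differentiableAt
  set K : Matrix I I ℂ := of fun i j => deriv (fun s => (M s)⁻¹ i j) s with hK
  have hN (i j) : HasDerivAt (fun s => (M s)⁻¹ i j) (K i j) s :=
    (differentiableAt_inv hd hdet i j).hasDerivAt
  have hunit : IsUnit (M s).det := hdet.isUnit
  have hmul : M' * (M s)⁻¹ + M s * K = 0 := by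
    ext i j
    have h₁ : HasDerivAt (fun s => (M s * (M s)⁻¹) i j)
        ((M' * (M s)⁻¹ + M s * K) i j) s := by
      simp only [mul_apply, Matrix.add_apply, ← Finset.sum_add_distrib]
      exact HasDerivAt.fun_sum fun k _ => (hM i k).mul (hN k j)
    have h₂ : (fun s => (M s * (M s)⁻¹) i j) =ᶠ[nhds s] fun _ => (1 : Matrix I I ℂ) i j := by
      filter_upwards [(differentiableAt_det hd).continuousAt.eventually_ne hdet] with r hr
      rw [mul_nonsing_inv _ hr.isUnit]
    exact h₁.unique ((hasDerivAt_const s _).congr_of_eventuallyEq h₂)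
  have hKe : K = -((M s)⁻¹ * M' * (M s)⁻¹) := by
    have h := congrArg (fun A => (M s)⁻¹ * A) hmul
    simp only [mul_add, ← mul_assoc, nonsing_inv_mul _ hunit, one_mul, mul_zero] at h
    exact eq_neg_of_add_eq_zero_right h
  have h₁ : HasDerivAt (fun s => bracket (M s) (u s) (v s))
      (u' ⬝ᵥ ((M s)⁻¹ *ᵥ v s) + u s ⬝ᵥ (K *ᵥ v s + (M s)⁻¹ *ᵥ v')) s := by
    simp only [bracket, dotProduct, mulVec, Pi.add_apply, ← Finset.sum_add_distrib]
    refine HasDerivAt.fun_sum fun i _ => ?_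
    refine (hu i).mul (HasDerivAt.fun_sum fun j _ => ?_)
    exact (hN i j).mul (hv j)
  refine h₁.congr_deriv ?_
  simp only [bracket, hKe, dotProduct_add, neg_mulVec, dotProduct_neg, ← mulVec_mulVec]
  ring

/-- The derivative of `bracket` along a perturbation of rank two of the matrix. -/
theorem hasDerivAt_bracket_of_rank_two {M : ℝ → Matrix I I ℂ} {u v : ℝ → I → ℂ}
    {α β u' v' : I → ℂ} {c : ℂ} {s : ℝ}
    (hM : ∀ i j, HasDerivAt (fun s => M s i j) (c * (α i * β j - β i * α j)) s)
    (hu : ∀ i, HasDerivAt (fun s => u s i) (u' i) s)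
    (hv : ∀ i, HasDerivAt (fun s => v s i) (v' i) s) (hdet : (M s).det ≠ 0) :
    HasDerivAt (fun s => bracket (M s) (u s) (v s))
      (bracket (M s) u' (v s) + bracket (M s) (u s) v' -
        c * (bracket (M s) (u s) α * bracket (M s) β (v s) -
          bracket (M s) (u s) β * bracket (M s) α (v s))) s := by
  refine (hasDerivAt_bracket (M' := of fun i j => c * (α i * β j - β i * α j)) hM hu hv
    hdet).congr_deriv ?_
  have h : (of fun i j => c * (α i * β j - β i * α j)) *ᵥ ((M s)⁻¹ *ᵥ v s) =
      (c * bracket (M s) β (v s)) • α + (-(c * bracket (M s) α (v s))) • β := by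
    ext i
    unfold bracket
    generalize (M s)⁻¹ *ᵥ v s = X
    simp only [mulVec, dotProduct, of_apply, Pi.add_apply, Pi.smul_apply, smul_eq_mul,
      Finset.mul_sum, Finset.sum_mul, ← Finset.sum_add_distrib, ← Finset.sum_neg_distrib]
    exact Finset.sum_congr rfl fun j _ => by ring
  rw [h, bracket_add_right, bracket_smul_right, bracket_smul_right]
  ring

/-- If `h_i M_{ij} - M_{ij} h_j` is a sum of products `x_k(i) y_k(j)`, the form of `M⁻¹`
satisfies a quadratic relation. -/
theorem bracket_quadratic {M : Matrix I I ℂ} (hM : Mᵀ = -M) (hdet : M.det ≠ 0) (h u : I → ℂ)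
    {K : Type*} [Fintype K] (x y : K → I → ℂ) (c : K → ℂ)
    (hK : ∀ i j, (h i - h j) * M i j = ∑ k, c k * (x k i * y k j)) :
    ∑ k, c k * (bracket M u (x k) * bracket M u (y k)) =
      -2 * bracket M u (fun i => h i * u i) := by
  -- The sum of X_i X_j (h_i - h_j) M_ij is computed twice: from MX = u together with antisymmetry
  -- (`h₁`), and from the given decomposition (`h₂`).
  set X : I → ℂ := M⁻¹ *ᵥ u with hX
  have hb (v : I → ℂ) : bracket M u v = -∑ i, v i * X i := by
    rw [bracket_antisymm hM]; rfl
  have hMX (i) : ∑ j, M i j * X j = u i := by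
    have : M *ᵥ X = u := by
      rw [hX, mulVec_mulVec, mul_nonsing_inv _ hdet.isUnit, one_mulVec]
    exact congrFun this i
  have hMX' (j) : ∑ i, M i j * X i = -u j := by
    rw [← hMX j, ← Finset.sum_neg_distrib]
    refine Finset.sum_congr rfl fun i _ => ?_
    have : M i j = -M j i := by rw [← transpose_apply M, hM, neg_apply]
    rw [this]; ring
  have h₁ : ∑ i, ∑ j, X i * X j * ((h i - h j) * M i j) = 2 * ∑ i, h i * u i * X i := by
    have e₁ : ∑ i, ∑ j, X i * X j * (h i * M i j) = ∑ i, h i * u i * X i := by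
      refine Finset.sum_congr rfl fun i _ => ?_
      rw [← hMX i, Finset.mul_sum, Finset.sum_mul]
      exact Finset.sum_congr rfl fun j _ => by ring
    have e₂ : ∑ i, ∑ j, X i * X j * (h j * M i j) = -∑ i, h i * u i * X i := by
      rw [Finset.sum_comm, ← Finset.sum_neg_distrib]
      refine Finset.sum_congr rfl fun j _ => ?_
      have : -(h j * u j * X j) = h j * X j * (-u j) := by ring
      rw [this, ← hMX' j, Finset.mul_sum]
      exact Finset.sum_congr rfl fun i _ => by ring
    simp only [sub_mul, mul_sub, Finset.sum_sub_distrib, e₁, e₂]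
    ring
  have h₂ : ∑ i, ∑ j, X i * X j * ((h i - h j) * M i j) =
      ∑ k, c k * (bracket M u (x k) * bracket M u (y k)) := by
    simp only [hK, hb, neg_mul_neg, Finset.sum_mul_sum]
    simp only [Finset.mul_sum]
    rw [Finset.sum_congr rfl fun i _ => Finset.sum_comm, Finset.sum_comm]
    exact Finset.sum_congr rfl fun _ _ => Finset.sum_congr rfl fun _ _ =>
      Finset.sum_congr rfl fun _ _ => by ring
  rw [← h₂, h₁, hb]
  ring

/-- The form of `M⁻¹` after conjugation, if conjugation permutes the rows and columns of `M`. -/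
theorem conj_bracket {M : Matrix I I ℂ} (π : Equiv.Perm I) (hdet : M.det ≠ 0)
    (hM : ∀ i j, conj (M i j) = M (π i) (π j)) (u v : I → ℂ) :
    conj (bracket M u v) =
      bracket M (fun i => conj (u (π.symm i))) (fun i => conj (v (π.symm i))) := by
  -- Conjugation and simultaneous permutation of rows and columns both commute with inversion.
  have hinv (i j) : conj (M⁻¹ i j) = M⁻¹ (π i) (π j) := by
    have h : (M.map conj)⁻¹ = (M⁻¹).map conj := by
      refine inv_eq_left_inv ?_
      rw [← Matrix.map_mul, nonsing_inv_mul _ hdet.isUnit]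
      simp
    have h' : M.map conj = M.submatrix π π := by ext i j; exact hM i j
    rw [h', inv_submatrix_equiv] at h
    exact (congrFun (congrFun h i) j).symm
  simp only [bracket, dotProduct, mulVec, map_sum, map_mul, hinv]
  refine (Finset.sum_congr rfl fun i _ => ?_).trans
    (Equiv.sum_comp π fun i => conj (u (π.symm i)) * ∑ j, M⁻¹ i j * conj (v (π.symm j)))
  rw [π.symm_apply_apply, ← Equiv.sum_comp π fun j => M⁻¹ (π i) j * conj (v (π.symm j))]
  simp only [π.symm_apply_apply]

end Bracket

/-! ### Calculus in two variables -/

section Calculus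

open Function Filter Topology

variable {E : Type*} [NormedAddCommGroup E] [NormedSpace ℝ E]

theorem hasDerivAt_mk_left (x t : ℝ) : HasDerivAt (fun s : ℝ => (s, t)) ((1, 0) : ℝ × ℝ) x :=
  (hasDerivAt_id x).prodMk (hasDerivAt_const x t)

theorem hasDerivAt_mk_right (x t : ℝ) : HasDerivAt (fun s : ℝ => (x, s)) ((0, 1) : ℝ × ℝ) t :=
  (hasDerivAt_const t x).prodMk (hasDerivAt_id t)

theorem hasDerivAt_left {F : ℝ × ℝ → E} {x t : ℝ} (h : DifferentiableAt ℝ F (x, t)) :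
    HasDerivAt (fun s => F (s, t)) (fderiv ℝ F (x, t) (1, 0)) x :=
  h.hasFDerivAt.comp_hasDerivAt x (hasDerivAt_mk_left x t)

theorem hasDerivAt_right {F : ℝ × ℝ → E} {x t : ℝ} (h : DifferentiableAt ℝ F (x, t)) :
    HasDerivAt (fun s => F (x, s)) (fderiv ℝ F (x, t) (0, 1)) t :=
  h.hasFDerivAt.comp_hasDerivAt t (hasDerivAt_mk_right x t)

theorem hasDerivAt_dx {F : ℝ → ℝ → E} {x t : ℝ} (h : ContDiffAt ℝ ∞ (uncurry F) (x, t)) :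
    HasDerivAt (fun s => F s t) (dx F x t) x :=
  (hasDerivAt_left (h.differentiableAt (by simp))).differentiableAt.hasDerivAt

theorem hasDerivAt_dt {F : ℝ → ℝ → E} {x t : ℝ} (h : ContDiffAt ℝ ∞ (uncurry F) (x, t)) :
    HasDerivAt (fun s => F x s) (dt F x t) t :=
  (hasDerivAt_right (h.differentiableAt (by simp))).differentiableAt.hasDerivAt

/-- Order ∞ at a point gives a neighbourhood for each finite order, not one common to all orders. -/
theorem eventually_contDiffAt {V : Type*} [NormedAddCommGroup V] [NormedSpace ℝ V] {G : V → E}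
    {q : V} (h : ContDiffAt ℝ ∞ G q) (n : ℕ) : ∀ᶠ q' in 𝓝 q, ContDiffAt ℝ n G q' :=
  (h.of_le (by exact_mod_cast le_top)).eventually (by simp)

/-- The partial derivative is the total derivative applied to a fixed vector. Joint smoothness in
the extra parameter is what later allows the bilinear equations to be continued in the phase shift.
-/
theorem contDiffAt_param_dx {Y : Type*} [NormedAddCommGroup Y] [NormedSpace ℝ Y]
    {F : Y → ℝ → ℝ → E} {q : Y × ℝ × ℝ}
    (h : ContDiffAt ℝ ∞ (fun q : Y × ℝ × ℝ => F q.1 q.2.1 q.2.2) q) :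
    ContDiffAt ℝ ∞ (fun q : Y × ℝ × ℝ => dx (F q.1) q.2.1 q.2.2) q := by
  have h₁ : ContDiffAt ℝ ∞ (fun q => fderiv ℝ (fun q : Y × ℝ × ℝ => F q.1 q.2.1 q.2.2) q
      (0, 1, 0)) q := (h.fderiv_right (m := ∞) (by simp)).clm_apply contDiffAt_const
  refine h₁.congr_of_eventuallyEq ?_
  filter_upwards [eventually_contDiffAt h 1] with p hp
  have h₂ : HasDerivAt (fun s : ℝ => (p.1, s, p.2.2)) ((0, 1, 0) : Y × ℝ × ℝ) p.2.1 :=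
    (hasDerivAt_const _ _).prodMk (hasDerivAt_mk_left _ _)
  exact ((hp.differentiableAt (by simp)).hasFDerivAt.comp_hasDerivAt p.2.1 h₂).deriv

theorem contDiffAt_param_dt {Y : Type*} [NormedAddCommGroup Y] [NormedSpace ℝ Y]
    {F : Y → ℝ → ℝ → E} {q : Y × ℝ × ℝ}
    (h : ContDiffAt ℝ ∞ (fun q : Y × ℝ × ℝ => F q.1 q.2.1 q.2.2) q) :
    ContDiffAt ℝ ∞ (fun q : Y × ℝ × ℝ => dt (F q.1) q.2.1 q.2.2) q := by
  have h₁ : ContDiffAt ℝ ∞ (fun q => fderiv ℝ (fun q : Y × ℝ × ℝ => F q.1 q.2.1 q.2.2) q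
      (0, 0, 1)) q := (h.fderiv_right (m := ∞) (by simp)).clm_apply contDiffAt_const
  refine h₁.congr_of_eventuallyEq ?_
  filter_upwards [eventually_contDiffAt h 1] with p hp
  have h₂ : HasDerivAt (fun s : ℝ => (p.1, p.2.1, s)) ((0, 0, 1) : Y × ℝ × ℝ) p.2.2 :=
    (hasDerivAt_const _ _).prodMk (hasDerivAt_mk_right _ _)
  exact ((hp.differentiableAt (by simp)).hasFDerivAt.comp_hasDerivAt p.2.2 h₂).deriv

/-- A dummy parameter, set to 0, reduces the case of two variables to the parametric one. -/
theorem contDiffAt_param {F : ℝ → ℝ → E} {q : ℝ × ℝ} (h : ContDiffAt ℝ ∞ (uncurry F) q) :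
    ContDiffAt ℝ ∞ (fun p : ℝ × ℝ × ℝ => F p.2.1 p.2.2) (0, q) :=
  ContDiffAt.comp (g := uncurry F) ((0, q) : ℝ × ℝ × ℝ) h contDiffAt_snd

theorem contDiffAt_of_param {F : ℝ → ℝ → E} {q : ℝ × ℝ}
    (h : ContDiffAt ℝ ∞ (fun p : ℝ × ℝ × ℝ => F p.2.1 p.2.2) (0, q)) :
    ContDiffAt ℝ ∞ (uncurry F) q :=
  ContDiffAt.comp (f := fun q : ℝ × ℝ => ((0, q) : ℝ × ℝ × ℝ)) q h
    (contDiffAt_const.prodMk contDiffAt_id)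

theorem contDiffAt_dx {F : ℝ → ℝ → E} {q : ℝ × ℝ} (h : ContDiffAt ℝ ∞ (uncurry F) q) :
    ContDiffAt ℝ ∞ (uncurry (dx F)) q :=
  contDiffAt_of_param (contDiffAt_param_dx (F := fun _ : ℝ => F) (contDiffAt_param h))

theorem contDiffAt_dt {F : ℝ → ℝ → E} {q : ℝ × ℝ} (h : ContDiffAt ℝ ∞ (uncurry F) q) :
    ContDiffAt ℝ ∞ (uncurry (dt F)) q :=
  contDiffAt_of_param (contDiffAt_param_dt (F := fun _ : ℝ => F) (contDiffAt_param h))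

theorem dx_congr {F G : ℝ → ℝ → E} {x t : ℝ} (h : uncurry F =ᶠ[𝓝 (x, t)] uncurry G) :
    dx F x t = dx G x t :=
  EventuallyEq.deriv_eq ((hasDerivAt_mk_left x t).continuousAt.eventually h)

theorem dt_congr {F G : ℝ → ℝ → E} {x t : ℝ} (h : uncurry F =ᶠ[𝓝 (x, t)] uncurry G) :
    dt F x t = dt G x t :=
  EventuallyEq.deriv_eq ((hasDerivAt_mk_right x t).continuousAt.eventually h)

theorem dx_dt_comm {F : ℝ → ℝ → E} {x t : ℝ} (h : ContDiffAt ℝ ∞ (uncurry F) (x, t)) :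
    dx (dt F) x t = dt (dx F) x t := by
  have hsymm : IsSymmSndFDerivAt ℝ (uncurry F) (x, t) := by
    refine h.isSymmSndFDerivAt ?_
    simp only [minSmoothness_of_isRCLikeNormedField]
    exact WithTop.coe_le_coe.mpr le_top
  have hev : ∀ᶠ q in 𝓝 (x, t), DifferentiableAt ℝ (uncurry F) q := by
    filter_upwards [eventually_contDiffAt h 1] with p hp using hp.differentiableAt (by simp)
  have h₁ : uncurry (dt F) =ᶠ[𝓝 (x, t)] uncurry fun x t => fderiv ℝ (uncurry F) (x, t) (0, 1) := by
    filter_upwards [hev] with p hp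
    exact (hasDerivAt_right hp).deriv
  have h₂ : uncurry (dx F) =ᶠ[𝓝 (x, t)] uncurry fun x t => fderiv ℝ (uncurry F) (x, t) (1, 0) := by
    filter_upwards [hev] with p hp
    exact (hasDerivAt_left hp).deriv
  rw [dx_congr h₁, dt_congr h₂]
  have hd := (h.fderiv_right (m := ∞) (by simp)).differentiableAt (by simp)
  have e₁ := ((hasDerivAt_left hd).clm_apply (hasDerivAt_const x ((0, 1) : ℝ × ℝ))).deriv
  have e₂ := ((hasDerivAt_right hd).clm_apply (hasDerivAt_const t ((1, 0) : ℝ × ℝ))).deriv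
  rw [map_zero, add_zero] at e₁ e₂
  exact e₁.trans ((hsymm _ _).trans e₂.symm)

/-- The Hirota operator `D_x D_t` in terms of partial derivatives. -/
theorem hirota_one_one {f g : ℝ → ℝ → ℂ} (hf : ContDiff ℝ ∞ (uncurry f))
    (hg : ContDiff ℝ ∞ (uncurry g)) (x t : ℝ) :
    hirota 1 1 f g x t = dx (dt f) x t * g x t + f x t * dx (dt g) x t -
      dx f x t * dt g x t - dt f x t * dx g x t := by
  have shift {F : ℝ → ℂ} {F' : ℂ} {y : ℝ} (h : HasDerivAt F F' y) :
      HasDerivAt (fun ε => F (y + ε)) F' 0 := by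
    have := HasDerivAt.comp_const_add (f := F) (f' := F') y 0 (by simpa using h)
    exact this
  have shift' {F : ℝ → ℂ} {F' : ℂ} {y : ℝ} (h : HasDerivAt F F' y) :
      HasDerivAt (fun ε => F (y - ε)) (-F') 0 :=
    HasDerivAt.comp_const_sub (f := F) (f' := F') y 0 (by simpa using h)
  have h₁ (ε : ℝ) : deriv (fun δ : ℝ => f (x + ε) (t + δ) * g (x - ε) (t - δ)) 0 =
      dt f (x + ε) t * g (x - ε) t - f (x + ε) t * dt g (x - ε) t := by
    have := ((shift (hasDerivAt_dt (x := x + ε) (t := t) hf.contDiffAt)).mul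
      (shift' (hasDerivAt_dt (x := x - ε) (t := t) hg.contDiffAt))).deriv
    refine this.trans ?_
    simp only [add_zero, sub_zero]
    ring
  simp only [hirota, iteratedDeriv_one, h₁]
  have h₂ := (((shift (hasDerivAt_dx (contDiffAt_dt (q := (x, t)) hf.contDiffAt))).mul
    (shift' (hasDerivAt_dx (x := x) (t := t) hg.contDiffAt))).sub
    ((shift (hasDerivAt_dx (x := x) (t := t) hf.contDiffAt)).mul
    (shift' (hasDerivAt_dx (contDiffAt_dt (q := (x, t)) hg.contDiffAt))))).deriv
  refine h₂.trans ?_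
  simp only [add_zero, sub_zero]
  ring

/-- The Hirota operator `D_x²` in terms of partial derivatives. -/
theorem hirota_two_zero {f : ℝ → ℝ → ℂ} (hf : ContDiff ℝ ∞ (uncurry f)) (x t : ℝ) :
    hirota 2 0 f f x t = 2 * (f x t * dx (dx f) x t - dx f x t ^ 2) := by
  have hd (y) : HasDerivAt (fun s => f s t) (dx f y t) y := hasDerivAt_dx hf.contDiffAt
  have hdd (y) : HasDerivAt (fun s => dx f s t) (dx (dx f) y t) y :=
    hasDerivAt_dx (contDiffAt_dx hf.contDiffAt)
  have add {F F' : ℝ → ℂ} (h : ∀ y, HasDerivAt F (F' y) y) (ε : ℝ) :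
      HasDerivAt (fun ε => F (x + ε)) (F' (x + ε)) ε := (h (x + ε)).comp_const_add x ε
  have sub {F F' : ℝ → ℂ} (h : ∀ y, HasDerivAt F (F' y) y) (ε : ℝ) :
      HasDerivAt (fun ε => F (x - ε)) (-F' (x - ε)) ε := (h (x - ε)).comp_const_sub x ε
  have h₁ : deriv (fun ε : ℝ => f (x + ε) t * f (x - ε) t) = fun ε =>
      dx f (x + ε) t * f (x - ε) t + f (x + ε) t * -dx f (x - ε) t :=
    funext fun ε => ((add hd ε).mul (sub hd ε)).deriv
  have h₂ : HasDerivAt (fun ε =>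
      dx f (x + ε) t * f (x - ε) t + f (x + ε) t * -dx f (x - ε) t) _ 0 :=
    ((add hdd 0).mul (sub hd 0)).add ((add hd 0).mul (sub hdd 0).neg)
  simp only [hirota, iteratedDeriv_succ, iteratedDeriv_zero, add_zero, sub_zero, h₁]
  rw [h₂.deriv]
  simp only [add_zero, sub_zero]
  ring

/-! ### Logarithmic derivatives and quotients -/

theorem contDiffAt_log {ρ : ℝ → ℝ → ℝ} {q : ℝ × ℝ} (hρ : ContDiffAt ℝ ∞ (uncurry ρ) q)
    (h0 : ρ q.1 q.2 ≠ 0) : ContDiffAt ℝ ∞ (uncurry fun x t => Real.log (ρ x t)) q :=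
  ContDiffAt.log hρ h0

/-- `Real.log` is the logarithm of the absolute value, so the sign of ρ does not matter. -/
theorem dx_log {ρ : ℝ → ℝ → ℝ} {x t : ℝ} (hρ : ContDiff ℝ ∞ (uncurry ρ)) (h0 : ρ x t ≠ 0) :
    uncurry (dx fun x t => Real.log (ρ x t)) =ᶠ[𝓝 (x, t)]
      uncurry fun x t => dx ρ x t / ρ x t := by
  filter_upwards [hρ.continuous.continuousAt.eventually_ne (x := (x, t)) (y := 0) h0] with p hp
  exact ((hasDerivAt_dx (x := p.1) (t := p.2) hρ.contDiffAt).log hp).deriv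

theorem dt_dx_log {ρ : ℝ → ℝ → ℝ} {x t : ℝ} (hρ : ContDiff ℝ ∞ (uncurry ρ)) (h0 : ρ x t ≠ 0) :
    dt (dx fun x t => Real.log (ρ x t)) x t =
      (dt (dx ρ) x t * ρ x t - dx ρ x t * dt ρ x t) / ρ x t ^ 2 := by
  rw [dt_congr (dx_log hρ h0)]
  exact ((hasDerivAt_dt (contDiffAt_dx (q := (x, t)) hρ.contDiffAt)).div
    (hasDerivAt_dt (x := x) (t := t) hρ.contDiffAt) h0).deriv

theorem dx_dx_log {ρ : ℝ → ℝ → ℝ} {x t : ℝ} (hρ : ContDiff ℝ ∞ (uncurry ρ)) (h0 : ρ x t ≠ 0) :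
    dx (dx fun x t => Real.log (ρ x t)) x t =
      (dx (dx ρ) x t * ρ x t - dx ρ x t * dx ρ x t) / ρ x t ^ 2 := by
  rw [dx_congr (dx_log hρ h0)]
  exact ((hasDerivAt_dx (contDiffAt_dx (q := (x, t)) hρ.contDiffAt)).div
    (hasDerivAt_dx (x := x) (t := t) hρ.contDiffAt) h0).deriv

theorem dt_dx_div {f g : ℝ → ℝ → ℂ} {x t : ℝ} (hf : ContDiff ℝ ∞ (uncurry f))
    (hg : ContDiff ℝ ∞ (uncurry g)) (h0 : f x t ≠ 0) :
    dt (dx fun x t => g x t / f x t) x t =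
      ((dt (dx g) x t * f x t + dx g x t * dt f x t -
        (dt g x t * dx f x t + g x t * dt (dx f) x t)) * f x t ^ 2 -
        (dx g x t * f x t - g x t * dx f x t) * (2 * f x t * dt f x t)) / (f x t ^ 2) ^ 2 := by
  have h : uncurry (dx fun x t => g x t / f x t) =ᶠ[𝓝 (x, t)]
      uncurry fun x t => (dx g x t * f x t - g x t * dx f x t) / f x t ^ 2 := by
    filter_upwards [hf.continuous.continuousAt.eventually_ne (x := (x, t)) (y := 0) h0] with p hp
    exact ((hasDerivAt_dx (x := p.1) (t := p.2) hg.contDiffAt).div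
      (hasDerivAt_dx (x := p.1) (t := p.2) hf.contDiffAt) hp).deriv
  rw [dt_congr h]
  have hf' := hasDerivAt_dt (x := x) (t := t) hf.contDiffAt
  have hg' := hasDerivAt_dt (x := x) (t := t) hg.contDiffAt
  have hfx := hasDerivAt_dt (contDiffAt_dx (q := (x, t)) hf.contDiffAt)
  have hgx := hasDerivAt_dt (contDiffAt_dx (q := (x, t)) hg.contDiffAt)
  refine (((((hgx.mul hf').sub (hg'.mul hfx)).div (hf'.pow 2) (pow_ne_zero 2 h0))).deriv).trans ?_
  simp

end Calculus

/-! ### From the bilinear equations to the AB systems -/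

section Solution

open Function Filter Topology

variable {E : Type*} [NormedAddCommGroup E] [NormedSpace ℝ E]

theorem dx_ofReal {ρ : ℝ → ℝ → ℝ} {x t : ℝ} (h : ContDiffAt ℝ ∞ (uncurry ρ) (x, t)) :
    dx (fun x t => (ρ x t : ℂ)) x t = dx ρ x t :=
  (hasDerivAt_dx h).ofReal_comp.deriv

theorem dt_ofReal {ρ : ℝ → ℝ → ℝ} {x t : ℝ} (h : ContDiffAt ℝ ∞ (uncurry ρ) (x, t)) :
    dt (fun x t => (ρ x t : ℂ)) x t = dt ρ x t :=
  (hasDerivAt_dt h).ofReal_comp.deriv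

theorem contDiff_ofReal {ρ : ℝ → ℝ → ℝ} (h : ContDiff ℝ ∞ (uncurry ρ)) :
    ContDiff ℝ ∞ (uncurry fun x t => (ρ x t : ℂ)) :=
  Complex.ofRealCLM.contDiff.comp h

/-- If `D_x D_t g·ρ = c g ρ`, then `A = g / ρ` satisfies `A_{xt} = c A - 2 A (ln |ρ|)_{xt}`. -/
theorem dt_dx_div_of_bilinear {ρ : ℝ → ℝ → ℝ} {g : ℝ → ℝ → ℂ} {c : ℂ}
    (hρ : ContDiff ℝ ∞ (uncurry ρ)) (hg : ContDiff ℝ ∞ (uncurry g)) {x t : ℝ}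
    (h : hirota 1 1 g (fun x t => (ρ x t : ℂ)) x t = c * g x t * ρ x t) (h0 : ρ x t ≠ 0) :
    dt (dx fun x t => g x t / (ρ x t : ℂ)) x t = c * (g x t / ρ x t) -
      2 * (g x t / ρ x t) * (dt (dx fun x t => Real.log (ρ x t)) x t : ℝ) := by
  have h0' : (ρ x t : ℂ) ≠ 0 := by exact_mod_cast h0
  have hfx : dx (fun x t => (ρ x t : ℂ)) = fun x t => ((dx ρ x t : ℝ) : ℂ) := by
    funext x t; exact dx_ofReal hρ.contDiffAt
  have hft : dt (fun x t => (ρ x t : ℂ)) x t = dt ρ x t := dt_ofReal hρ.contDiffAt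
  have hfxt : dt (fun x t => ((dx ρ x t : ℝ) : ℂ)) x t = dt (dx ρ) x t :=
    dt_ofReal (contDiffAt_dx hρ.contDiffAt)
  rw [hirota_one_one hg (contDiff_ofReal hρ), dx_dt_comm hg.contDiffAt,
    dx_dt_comm (contDiff_ofReal hρ).contDiffAt, hfx, hft, hfxt] at h
  rw [dt_dx_div (contDiff_ofReal hρ) hg h0', dt_dx_log hρ h0, hfx, hft, hfxt]
  push_cast
  field_simp
  -- Once denominators are cleared, the claim is the bilinear equation times ρ.
  linear_combination (ρ x t : ℂ) * h

theorem contDiffAt_div_ofReal {ρ : ℝ → ℝ → ℝ} {g : ℝ → ℝ → ℂ}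
    (hρ : ContDiff ℝ ∞ (uncurry ρ)) (hg : ContDiff ℝ ∞ (uncurry g)) {q : ℝ × ℝ}
    (h0 : (ρ q.1 q.2 : ℂ) ≠ 0) :
    ContDiffAt ℝ ∞ (uncurry fun x t => g x t / (ρ x t : ℂ)) q := by
  simp only [div_eq_mul_inv]
  have h := (contDiff_ofReal hρ).contDiffAt (x := q)
  exact hg.contDiffAt.mul (h.inv h0)

/-- Divided by ρ², the third bilinear equation reads 2(ln|ρ|)_xx + r²σ = σ(|A₁|² + |A₂|²). Its
t-derivative loses the constant, and 2(ln|ρ|)_xxt is B_x. -/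
theorem isCanonicalSolutionOn_of_bilinear {ρ : ℝ → ℝ → ℝ} {g₁ g₂ : ℝ → ℝ → ℂ} {μ σ lam r : ℝ}
    (hρ : ContDiff ℝ ∞ (uncurry ρ)) (hg₁ : ContDiff ℝ ∞ (uncurry g₁))
    (hg₂ : ContDiff ℝ ∞ (uncurry g₂))
    (h₁ : ∀ x t, hirota 1 1 g₁ (fun x t => (ρ x t : ℂ)) x t = (μ + lam) * g₁ x t * ρ x t)
    (h₂ : ∀ x t, hirota 1 1 g₂ (fun x t => (ρ x t : ℂ)) x t = (μ + lam) * g₂ x t * ρ x t)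
    (h₃ : ∀ x t, hirota 2 0 (fun x t => (ρ x t : ℂ)) (fun x t => (ρ x t : ℂ)) x t +
      r ^ 2 * σ * (ρ x t * ρ x t) = σ * ((‖g₁ x t‖ : ℂ) ^ 2 + (‖g₂ x t‖ : ℂ) ^ 2)) :
    IsCanonicalSolutionOn μ σ (fun x t => g₁ x t / (ρ x t : ℂ)) (fun x t => g₂ x t / (ρ x t : ℂ))
      (fun x t => 2 * dt (dx fun x t => Real.log (ρ x t)) x t - lam)
      {q | (ρ q.1 q.2 : ℂ) ≠ 0} := by
  have hlog {q : ℝ × ℝ} (hq : ρ q.1 q.2 ≠ 0) :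
      ContDiffAt ℝ ∞ (uncurry fun x t => Real.log (ρ x t)) q :=
    contDiffAt_log hρ.contDiffAt hq
  have hopen : IsOpen {q : ℝ × ℝ | (ρ q.1 q.2 : ℂ) ≠ 0} :=
    isOpen_ne_fun (contDiff_ofReal hρ).continuous continuous_const
  refine ⟨hopen, fun q hq => ?_, fun q hq => ?_, fun q hq => ?_, fun x t hq => ?_⟩
  · exact (contDiffAt_div_ofReal hρ hg₁ hq).contDiffWithinAt
  · exact (contDiffAt_div_ofReal hρ hg₂ hq).contDiffWithinAt
  · have hq : ρ q.1 q.2 ≠ 0 := by exact_mod_cast hq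
    exact ((contDiffAt_const.mul (contDiffAt_dt (contDiffAt_dx (hlog hq)))).sub
      contDiffAt_const).contDiffWithinAt
  · have h0 : ρ x t ≠ 0 := by exact_mod_cast hq
    refine ⟨?_, ?_, ?_⟩
    · rw [dt_dx_div_of_bilinear hρ hg₁ (h₁ x t) h0]
      push_cast
      ring
    · rw [dt_dx_div_of_bilinear hρ hg₂ (h₂ x t) h0]
      push_cast
      ring
    · have hB : dx (fun x t => 2 * dt (dx fun x t => Real.log (ρ x t)) x t - lam) x t =
          2 * dt (dx (dx fun x t => Real.log (ρ x t))) x t := by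
        rw [← dx_dt_comm (contDiffAt_dx (hlog (q := (x, t)) h0))]
        exact (((hasDerivAt_dx (contDiffAt_dt (contDiffAt_dx (hlog (q := (x, t)) h0)))).const_mul
          2).sub_const lam).deriv
      have hev : uncurry (fun x t => σ * (‖g₁ x t / (ρ x t : ℂ)‖ ^ 2 + ‖g₂ x t / (ρ x t : ℂ)‖ ^ 2))
          =ᶠ[𝓝 (x, t)] uncurry fun x t =>
            2 * dx (dx fun x t => Real.log (ρ x t)) x t + r ^ 2 * σ := by
        filter_upwards [hopen.mem_nhds hq] with p hp
        have hp : ρ p.1 p.2 ≠ 0 := by exact_mod_cast hp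
        have h := h₃ p.1 p.2
        have hfx : dx (fun x t => (ρ x t : ℂ)) = fun x t => ((dx ρ x t : ℝ) : ℂ) := by
          funext x t; exact dx_ofReal hρ.contDiffAt
        rw [hirota_two_zero (contDiff_ofReal hρ), hfx,
          dx_ofReal (contDiffAt_dx hρ.contDiffAt)] at h
        beta_reduce at h
        norm_cast at h
        simp only [uncurry_def, dx_dx_log hρ hp, norm_div, div_pow, Complex.norm_real,
          Real.norm_eq_abs, sq_abs]
        field_simp
        linear_combination -h
      have hA : σ * dt (fun x t => ‖g₁ x t / (ρ x t : ℂ)‖ ^ 2 + ‖g₂ x t / (ρ x t : ℂ)‖ ^ 2) x t =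
          dt (fun x t => σ * (‖g₁ x t / (ρ x t : ℂ)‖ ^ 2 + ‖g₂ x t / (ρ x t : ℂ)‖ ^ 2)) x t :=
        (deriv_const_mul_field σ).symm
      rw [hB, hA, dt_congr hev]
      exact (((hasDerivAt_dt (contDiffAt_dx (contDiffAt_dx (hlog (q := (x, t)) h0)))).const_mul
        2).add_const (r ^ 2 * σ)).deriv.symm

/-! ### Change of coordinates -/

theorem contDiffAt_comp_coords {F : ℝ → ℝ → E} {c₁ c₂ : ℝ} {q : ℝ × ℝ}
    (h : ContDiffAt ℝ ∞ (uncurry F) (q.1 - c₁ * q.2, q.2 - q.1 / c₂)) :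
    ContDiffAt ℝ ∞ (uncurry fun X T => F (X - c₁ * T) (T - X / c₂)) q := by
  refine ContDiffAt.comp (g := uncurry F)
    (f := fun q : ℝ × ℝ => (q.1 - c₁ * q.2, q.2 - q.1 / c₂)) q h ?_
  exact ContDiff.contDiffAt (by fun_prop)

theorem dx_comp_coords {F : ℝ → ℝ → E} {c₁ c₂ X T : ℝ}
    (h : ContDiffAt ℝ ∞ (uncurry F) (X - c₁ * T, T - X / c₂)) :
    dx (fun X T => F (X - c₁ * T) (T - X / c₂)) X T =
      dx F (X - c₁ * T) (T - X / c₂) - (1 / c₂) • dt F (X - c₁ * T) (T - X / c₂) := by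
  have hd := h.differentiableAt (by simp)
  have hl : HasDerivAt (fun X : ℝ => (X - c₁ * T, T - X / c₂)) ((1, -(1 / c₂)) : ℝ × ℝ) X :=
    ((hasDerivAt_id X).sub_const _).prodMk (((hasDerivAt_id X).div_const c₂).const_sub T)
  have h₁ := (hd.hasFDerivAt.comp_hasDerivAt X hl).deriv
  refine h₁.trans ?_
  have e : ((1, -(1 / c₂)) : ℝ × ℝ) = (1, 0) - (1 / c₂) • (0, 1) := by simp
  rw [e, map_sub, map_smul]
  congr 1
  · exact (hasDerivAt_left hd).deriv.symm
  · rw [← (hasDerivAt_right hd).deriv]; rfl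

theorem dt_comp_coords {F : ℝ → ℝ → E} {c₁ c₂ X T : ℝ}
    (h : ContDiffAt ℝ ∞ (uncurry F) (X - c₁ * T, T - X / c₂)) :
    dt (fun X T => F (X - c₁ * T) (T - X / c₂)) X T =
      dt F (X - c₁ * T) (T - X / c₂) - c₁ • dx F (X - c₁ * T) (T - X / c₂) := by
  have hd := h.differentiableAt (by simp)
  have hl : HasDerivAt (fun T : ℝ => (X - c₁ * T, T - X / c₂)) ((-(c₁ * 1), 1) : ℝ × ℝ) T :=
    (((hasDerivAt_id T).const_mul c₁).const_sub X).prodMk ((hasDerivAt_id T).sub_const _)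
  have h₁ := (hd.hasFDerivAt.comp_hasDerivAt T hl).deriv
  refine h₁.trans ?_
  have e : ((-(c₁ * 1), 1) : ℝ × ℝ) = (0, 1) - c₁ • (1, 0) := by simp
  rw [e, map_sub, map_smul]
  congr 1
  · exact (hasDerivAt_right hd).deriv.symm
  · rw [← (hasDerivAt_left hd).deriv]; rfl

/-- The operator ∂_T + c₁∂_X annihilates x = X - c₁T, so only the t-derivative survives. -/
theorem transport_fst_comp_coords {F : ℝ → ℝ → E} {c₁ c₂ X T : ℝ}
    (h : ContDiffAt ℝ ∞ (uncurry F) (X - c₁ * T, T - X / c₂)) :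
    transport c₁ (fun X T => F (X - c₁ * T) (T - X / c₂)) X T =
      (1 - c₁ / c₂) • dt F (X - c₁ * T) (T - X / c₂) := by
  rw [transport, dx_comp_coords h, dt_comp_coords h]
  module

/-- The operator ∂_T + c₂∂_X annihilates t = T - X/c₂, so only the x-derivative survives. -/
theorem transport_snd_comp_coords {F : ℝ → ℝ → E} {c₁ c₂ X T : ℝ} (hc₂ : c₂ ≠ 0)
    (h : ContDiffAt ℝ ∞ (uncurry F) (X - c₁ * T, T - X / c₂)) :
    transport c₂ (fun X T => F (X - c₁ * T) (T - X / c₂)) X T =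
      (c₂ - c₁) • dx F (X - c₁ * T) (T - X / c₂) := by
  rw [transport, dx_comp_coords h, dt_comp_coords h, smul_sub, smul_smul,
    mul_one_div_cancel hc₂]
  module

theorem transport_congr {F G : ℝ → ℝ → E} {c X T : ℝ} (h : uncurry F =ᶠ[𝓝 (X, T)] uncurry G) :
    transport c F X T = transport c G X T := by
  rw [transport, transport, dx_congr h, dt_congr h]

/-- The composed operators become (1 - c₁/c₂)(c₂ - c₁)∂_x∂_t = ((c₁ - c₂)²/c₂)∂_x∂_t; the values of
μ and σ and the scaling of B₀ absorb this factor. -/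
theorem isSolutionOn_of_isCanonicalSolutionOn {μ σ : ℝ} {A₁ A₂ : ℝ → ℝ → ℂ} {B : ℝ → ℝ → ℝ}
    {U : Set (ℝ × ℝ)} (h : IsCanonicalSolutionOn μ σ A₁ A₂ B U) {c₁ c₂ n₁ n₂ : ℝ} (hc : c₁ ≠ c₂)
    (hc₂ : c₂ ≠ 0) (hn₂ : n₂ ≠ 0) (hμ : μ = n₁ * c₂ / (c₁ - c₂) ^ 2)
    (hσ : σ = n₂ / (c₁ - c₂) ^ 2) :
    IsSolutionOn c₁ c₂ n₁ n₂ (fun X T => A₁ (X - c₁ * T) (T - X / c₂))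
      (fun X T => A₂ (X - c₁ * T) (T - X / c₂))
      (fun X T => (c₁ - c₂) ^ 2 / (n₂ * c₂) * B (X - c₁ * T) (T - X / c₂))
      {q | (q.1 - c₁ * q.2, q.2 - q.1 / c₂) ∈ U} := by
  obtain ⟨hU, hA₁, hA₂, hB, h⟩ := h
  have hsub : c₁ - c₂ ≠ 0 := sub_ne_zero.mpr hc
  have hopen : IsOpen {q : ℝ × ℝ | (q.1 - c₁ * q.2, q.2 - q.1 / c₂) ∈ U} :=
    hU.preimage (by fun_prop)
  have at_of {E : Type} [NormedAddCommGroup E] [NormedSpace ℝ E] {F : ℝ → ℝ → E}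
      (hF : ContDiffOn ℝ ∞ (uncurry F) U) {q : ℝ × ℝ} (hq : q ∈ U) :
      ContDiffAt ℝ ∞ (uncurry F) q := hF.contDiffAt (hU.mem_nhds hq)
  have second {A : ℝ → ℝ → ℂ} (hA : ContDiffOn ℝ ∞ (uncurry A) U) {X T : ℝ}
      (hq : (X - c₁ * T, T - X / c₂) ∈ U)
      (hAB : dt (dx A) (X - c₁ * T) (T - X / c₂) = μ * A (X - c₁ * T) (T - X / c₂) -
        A (X - c₁ * T) (T - X / c₂) * B (X - c₁ * T) (T - X / c₂)) :
      transport c₁ (transport c₂ fun X T => A (X - c₁ * T) (T - X / c₂)) X T =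
        n₁ * A (X - c₁ * T) (T - X / c₂) - n₂ * A (X - c₁ * T) (T - X / c₂) *
          ((c₁ - c₂) ^ 2 / (n₂ * c₂) * B (X - c₁ * T) (T - X / c₂) : ℝ) := by
    have hev : uncurry (transport c₂ fun X T => A (X - c₁ * T) (T - X / c₂)) =ᶠ[𝓝 (X, T)]
        uncurry fun X T => (fun x t => (c₂ - c₁) • dx A x t) (X - c₁ * T) (T - X / c₂) := by
      filter_upwards [hopen.mem_nhds (x := (X, T)) hq] with p hp
      exact transport_snd_comp_coords hc₂ (at_of hA hp)
    have hd : dt (fun x t => (c₂ - c₁) • dx A x t) (X - c₁ * T) (T - X / c₂) =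
        (c₂ - c₁) • dt (dx A) (X - c₁ * T) (T - X / c₂) :=
      ((hasDerivAt_dt (contDiffAt_dx (at_of hA hq))).const_smul (c₂ - c₁)).deriv
    have hs : ContDiffAt ℝ ∞ (uncurry fun x t => (c₂ - c₁) • dx A x t)
        (X - c₁ * T, T - X / c₂) := (contDiffAt_dx (at_of hA hq)).const_smul (c₂ - c₁)
    have e := transport_fst_comp_coords hs
    rw [transport_congr hev, e, hd, hAB, hμ, smul_smul, Complex.real_smul]
    have e₁ : (c₁ : ℂ) - c₂ ≠ 0 := by exact_mod_cast hsub
    have e₂ : (c₂ : ℂ) ≠ 0 := by exact_mod_cast hc₂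
    have e₃ : (n₂ : ℂ) ≠ 0 := by exact_mod_cast hn₂
    push_cast
    field_simp
    ring
  refine ⟨hopen, fun q hq => ?_, fun q hq => ?_, fun q hq => ?_, fun X T hq => ?_⟩
  · exact (contDiffAt_comp_coords (at_of hA₁ hq)).contDiffWithinAt
  · exact (contDiffAt_comp_coords (at_of hA₂ hq)).contDiffWithinAt
  · exact (contDiffAt_const.mul (contDiffAt_comp_coords (at_of hB hq))).contDiffWithinAt
  · obtain ⟨h₁, h₂, h₃⟩ := h _ _ hq
    refine ⟨second hA₁ hq h₁, second hA₂ hq h₂, ?_⟩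
    have hn : ContDiffAt ℝ ∞ (uncurry fun x t => ‖A₁ x t‖ ^ 2 + ‖A₂ x t‖ ^ 2)
        (X - c₁ * T, T - X / c₂) :=
      ((at_of hA₁ hq).norm_sq ℝ).add ((at_of hA₂ hq).norm_sq ℝ)
    have hd : dx (fun x t => (c₁ - c₂) ^ 2 / (n₂ * c₂) * B x t) (X - c₁ * T) (T - X / c₂) =
        (c₁ - c₂) ^ 2 / (n₂ * c₂) * dx B (X - c₁ * T) (T - X / c₂) :=
      ((hasDerivAt_dx (at_of hB hq)).const_mul _).deriv
    have e := transport_snd_comp_coords (F := fun x t => (c₁ - c₂) ^ 2 / (n₂ * c₂) * B x t) hc₂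
      (contDiffAt_const.mul (at_of hB hq))
    refine e.trans (Eq.trans ?_ (transport_fst_comp_coords hn).symm)
    rw [hd, h₃, hσ, smul_eq_mul, smul_eq_mul]
    field_simp

end Solution

/-! ### The Pfaffian of the standard pairing -/

section StandardPairing

variable {ι : Type*}

theorem expand_append_singleton {φ : ι → ℂ} (F : List ι → ℂ) {l : List ι} (y : ι)
    (h : ∀ i ∈ l, φ i = 0) : expand φ F (l ++ [y]) = (-1) ^ l.length * (φ y * F l) := by
  induction l generalizing F with
  | nil => simp [expand_cons, expand_nil]
  | cons z l ih =>
    rw [List.cons_append, expand_cons, ih _ fun i hi => h i (List.mem_cons_of_mem z hi),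
      h z List.mem_cons_self, List.length_cons, pow_succ]
    ring

/-- The entries of the standard symplectic form. -/
def standardEntry [DecidableEq ι] : ι ⊕ ι → ι ⊕ ι → ℂ
  | .inl i, .inr j => if i = j then 1 else 0
  | .inr j, .inl i => -(if i = j then 1 else 0)
  | .inl _, .inl _ => 0
  | .inr _, .inr _ => 0

/-- The list `a_1, …, a_n, b_n, …, b_1` for `l = [1, …, n]`. -/
def pairedList (l : List ι) : List (ι ⊕ ι) := l.map Sum.inl ++ l.reverse.map Sum.inr

/-- The first label pairs only with the last one, and an even number of labels lies between them, so
the sign is +1. -/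
theorem pfaffian_standardEntry [DecidableEq ι] (l : List ι) (hl : l.Nodup) :
    pfaffian standardEntry (pairedList l) = 1 := by
  induction l with
  | nil => simp [pairedList, pfaffian_nil]
  | cons a l ih =>
    obtain ⟨ha, hl⟩ := List.nodup_cons.mp hl
    have h : pairedList (a :: l) = Sum.inl a :: (pairedList l ++ [Sum.inr a]) := by
      simp [pairedList]
    have h0 : ∀ i ∈ pairedList l, standardEntry (Sum.inl a) i = 0 := by
      rintro (i | i) hi
      · rfl
      · have : i ∈ l := by simpa [pairedList] using hi
        have hne : a ≠ i := fun e => ha (e ▸ this)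
        simp [standardEntry, hne]
    have hlen : (pairedList l).length = l.length + l.length := by simp [pairedList]
    rw [h, pfaffian_cons, expand_append_singleton _ _ h0, ih hl, hlen, ← two_mul, pow_mul]
    simp [standardEntry]

/-- Relabelling the pairs of labels does not change the Pfaffian. -/
theorem pfaffian_map_sumCongr [Fintype ι] [DecidableEq ι] {e : ι ⊕ ι → ι ⊕ ι → ℂ}
    (he : ∀ i j, e i j = -e j i) (τ : Equiv.Perm ι) {l : List ι} (hl : l.Nodup)
    (hmem : ∀ i, i ∈ l) :
    pfaffian e ((pairedList l).map (Equiv.sumCongr τ τ)) = pfaffian e (pairedList l) := by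
  have hnodup : (pairedList l).Nodup := by
    rw [pairedList, List.nodup_append']
    refine ⟨hl.map Sum.inl_injective, (List.nodup_reverse.mpr hl).map Sum.inr_injective, ?_⟩
    intro i hi hi'
    simp only [List.mem_map] at hi hi'
    obtain ⟨_, _, rfl⟩ := hi
    obtain ⟨_, _, h⟩ := hi'
    cases h
  have hall : ∀ i, i ∈ pairedList l := by rintro (i | i) <;> simp [pairedList, hmem]
  have hperm : ((pairedList l).map (Equiv.sumCongr τ τ)).Perm (pairedList l) := by
    rw [List.perm_ext_iff_of_nodup (hnodup.map (Equiv.injective _)) hnodup]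
    intro i
    refine ⟨fun _ => hall i, fun _ => List.mem_map.mpr ⟨(Equiv.sumCongr τ τ).symm i, hall _, ?_⟩⟩
    simp
  -- The sign ε does not depend on the entries. It is found from the standard form, which the
  -- relabelling preserves and whose Pfaffian is 1.
  obtain ⟨ε, hε⟩ := exists_pfaffian_perm hperm
  have hs : ∀ i j : ι ⊕ ι, standardEntry i j = -standardEntry j i := by
    rintro (i | i) (j | j) <;> simp [standardEntry]
  have h₁ := hε standardEntry hs []
  have h₂ : (fun i j : ι ⊕ ι => standardEntry (Equiv.sumCongr τ τ i) (Equiv.sumCongr τ τ j)) =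
      standardEntry := by
    funext i j
    rcases i with i | i <;> rcases j with j | j <;> simp [standardEntry]
  rw [List.nil_append, List.nil_append, pfaffian_map, h₂, pfaffian_standardEntry l hl,
    mul_one] at h₁
  have := hε e he []
  rwa [← h₁, one_mul] at this

end StandardPairing

/-! ### The matrix of the soliton solution -/

namespace Params

open Function

variable {N : ℕ} (P : Params N)

/-- The label with a given position: first the labels `a_j`, then the labels `b_j`. -/
def lbl {n : ℕ} : Fin n ⊕ Fin n → Label n := Sum.elim Label.a Label.b

/-- The antisymmetric matrix of the entries between the labels of `(•)`. -/
def mat (x t : ℝ) : Matrix (Fin (N + N) ⊕ Fin (N + N)) (Fin (N + N) ⊕ Fin (N + N)) ℂ :=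
  Matrix.of fun i j => P.entry x t (lbl i) (lbl j)

theorem coupling_comm (u v : ℂ) : P.coupling u v = P.coupling v u := by
  rw [coupling, coupling, mul_comm ((P.p : ℂ) ^ 2 + u ^ 2)]

theorem entry_antisymm (x t : ℝ) (i j : Label (N + N)) :
    P.entry x t i j = -P.entry x t j i := by
  cases i <;> cases j <;> simp only [entry, neg_neg, neg_zero]
  case a.a j l =>
    rw [← neg_sub (P.w l), neg_div, add_comm (P.w j), add_comm (P.η x t j)]
    ring
  case b.b j l =>
    rw [P.coupling_comm (P.w l), ← neg_sub (P.w j ^ 2), mul_comm (sgn N l), mul_neg, neg_mul,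
      div_neg, neg_neg]

theorem mat_transpose (x t : ℝ) : (P.mat x t).transpose = -P.mat x t := by
  ext i j
  exact P.entry_antisymm x t _ _

theorem bullet_eq (N : ℕ) : bullet N = (pairedList (List.finRange (N + N))).map lbl := by
  simp [bullet, pairedList, lbl, Function.comp_def]

theorem lbl_mem_bullet (i : Fin (N + N) ⊕ Fin (N + N)) : lbl i ∈ bullet N := by
  rcases i with i | i <;> simp [bullet, lbl]

theorem exists_lbl_of_mem_bullet {i : Label (N + N)} (h : i ∈ bullet N) : ∃ k, lbl k = i := by
  rw [bullet_eq, List.mem_map] at h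
  obtain ⟨k, -, hk⟩ := h
  exact ⟨k, hk⟩

/-- The same parameters with all `η_{j,0}` shifted by a real number. -/
def shift (s : ℝ) : Params N := { P with η₀ := fun j => P.η₀ j + s }

theorem shift_zero : P.shift 0 = P := by
  simp [shift]

theorem η_shift (s x t : ℝ) (j : Fin (N + N)) : (P.shift s).η x t j = P.η x t j + s := by
  refine Fin.addCases (fun j => ?_) (fun j => ?_) j
  · simp [η, shift, add_assoc, -Fin.natAdd_eq_addNat]
  · simp [η, shift, add_assoc, -Fin.natAdd_eq_addNat]

/-- As x, t, μ, λ are real, conjugation only replaces k_j by its conjugate, so one formula serves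
both halves of the indices. -/
theorem η_eq (x t : ℝ) (j : Fin (N + N)) :
    P.η x t j = P.w j * x + (P.μ + P.lam) / P.w j * t + P.η 0 0 j := by
  refine Fin.addCases (fun j => ?_) (fun j => ?_) j
  · simp [η, w, -Fin.natAdd_eq_addNat]
  · simp [η, w, -Fin.natAdd_eq_addNat]

theorem contDiff_η {n : WithTop ℕ∞} (j : Fin (N + N)) :
    ContDiff ℝ n fun q : ℝ × ℝ × ℝ => (P.shift q.1).η q.2.1 q.2.2 j := by
  have h : ContDiff ℝ n fun x : ℝ => (x : ℂ) := Complex.ofRealCLM.contDiff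
  have e : (fun q : ℝ × ℝ × ℝ => (P.shift q.1).η q.2.1 q.2.2 j) = fun q =>
      P.w j * q.2.1 + (P.μ + P.lam) / P.w j * q.2.2 + P.η 0 0 j + q.1 := by
    funext q
    rw [η_shift, η_eq]
  rw [e]
  exact (((contDiff_const.mul (h.comp (contDiff_fst.comp contDiff_snd))).add
    (contDiff_const.mul (h.comp (contDiff_snd.comp contDiff_snd)))).add contDiff_const).add
    (h.comp contDiff_fst)

theorem contDiff_entry {n : WithTop ℕ∞} (i j : Label (N + N)) :
    ContDiff ℝ n fun q : ℝ × ℝ × ℝ => (P.shift q.1).entry q.2.1 q.2.2 i j := by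
  have hw : ∀ s, (P.shift s).w = P.w := fun _ => rfl
  have hc : ∀ s, (P.shift s).coupling = P.coupling := fun _ => rfl
  have hp : ∀ s, (P.shift s).p = P.p := fun _ => rfl
  have hη := fun j => (P.contDiff_η (n := n) j).cexp
  have hηη := fun i j => ((P.contDiff_η (n := n) i).add (P.contDiff_η (n := n) j)).cexp
  cases i <;> cases j <;> simp only [entry, hw, hc, hp] <;>
    first
    | exact contDiff_const
    | exact contDiff_const.mul (hη _)
    | exact (contDiff_const.mul (hη _)).neg
    | exact contDiff_const.mul (hηη _ _)

theorem contDiff_f_shift {n : WithTop ℕ∞} :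
    ContDiff ℝ n fun q : ℝ × ℝ × ℝ => (P.shift q.1).f q.2.1 q.2.2 :=
  contDiff_pfaffian (e := fun q : ℝ × ℝ × ℝ => (P.shift q.1).entry q.2.1 q.2.2)
    P.contDiff_entry _

theorem contDiff_g₁_shift {n : WithTop ℕ∞} :
    ContDiff ℝ n fun q : ℝ × ℝ × ℝ => (P.shift q.1).g₁ q.2.1 q.2.2 :=
  contDiff_pfaffian (e := fun q : ℝ × ℝ × ℝ => (P.shift q.1).entry q.2.1 q.2.2)
    P.contDiff_entry _

theorem contDiff_g₂_shift {n : WithTop ℕ∞} :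
    ContDiff ℝ n fun q : ℝ × ℝ × ℝ => (P.shift q.1).g₂ q.2.1 q.2.2 := by
  have h : ContDiff ℝ n fun x : ℝ => (x : ℂ) := Complex.ofRealCLM.contDiff
  have hφ : ContDiff ℝ n fun q : ℝ × ℝ × ℝ => P.φ q.2.1 q.2.2 :=
    ((contDiff_const.mul (contDiff_fst.comp contDiff_snd)).sub
      (contDiff_const.mul (contDiff_snd.comp contDiff_snd))).add contDiff_const
  have hE : ContDiff ℝ n fun q : ℝ × ℝ × ℝ =>
      (P.r : ℂ) * Complex.exp (Complex.I * P.φ q.2.1 q.2.2) :=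
    contDiff_const.mul (contDiff_const.mul (h.comp hφ)).cexp
  exact hE.mul
    (contDiff_pfaffian (e := fun q : ℝ × ℝ × ℝ => (P.shift q.1).entry q.2.1 q.2.2)
      P.contDiff_entry _)

theorem contDiff_of_shift {n : WithTop ℕ∞} {F : Params N → ℝ → ℝ → ℂ}
    (h : ContDiff ℝ n fun q : ℝ × ℝ × ℝ => F (P.shift q.1) q.2.1 q.2.2) :
    ContDiff ℝ n (uncurry (F P)) := by
  have := h.comp (contDiff_const.prodMk contDiff_id : ContDiff ℝ n fun q : ℝ × ℝ => ((0 : ℝ), q))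
  simp only [comp_def, shift_zero] at this
  exact this

/-! ### Complex conjugation -/

/-- The permutation exchanging `j` and `N + j`. -/
def conjPerm (N : ℕ) : Equiv.Perm (Fin (N + N)) := finAddFlip

theorem w_conjPerm (j : Fin (N + N)) : P.w (conjPerm N j) = conj (P.w j) := by
  refine Fin.addCases (fun j => ?_) (fun j => ?_) j <;> simp [w, conjPerm, -Fin.natAdd_eq_addNat]

theorem η_conjPerm (x t : ℝ) (j : Fin (N + N)) :
    P.η x t (conjPerm N j) = conj (P.η x t j) := by
  refine Fin.addCases (fun j => ?_) (fun j => ?_) j <;> simp [η, conjPerm, -Fin.natAdd_eq_addNat]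

theorem sgn_conjPerm (j : Fin (N + N)) : sgn N (conjPerm N j) = -sgn N j := by
  refine Fin.addCases (fun j => ?_) (fun j => ?_) j <;> simp [sgn, conjPerm, -Fin.natAdd_eq_addNat]

theorem conj_sgn (j : Fin (N + N)) : conj (sgn N j) = sgn N j := by
  refine Fin.addCases (fun j => ?_) (fun j => ?_) j <;> simp [sgn, -Fin.natAdd_eq_addNat]

theorem conj_coupling (u v : ℂ) : conj (P.coupling u v) = P.coupling (conj u) (conj v) := by
  simp [coupling, Complex.conj_ofReal, Complex.conj_ofNat]

/-- Exchanging j and N+j conjugates w and η; it flips both signs, so the product of the two signs is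
unchanged. -/
theorem conj_mat (x t : ℝ) (i j : Fin (N + N) ⊕ Fin (N + N)) :
    conj (P.mat x t i j) = P.mat x t (Equiv.sumCongr (conjPerm N) (conjPerm N) i)
      (Equiv.sumCongr (conjPerm N) (conjPerm N) j) := by
  have h2 : conj (2 : ℂ) = 2 := Complex.conj_ofNat 2
  rcases i with i | i <;> rcases j with j | j <;>
    simp only [mat, Matrix.of_apply, lbl, Sum.elim_inl, Sum.elim_inr, entry, w_conjPerm,
      η_conjPerm, sgn_conjPerm, map_div₀, map_mul, map_sub, map_add, map_pow, map_one, map_neg,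
      conj_sgn, conj_coupling, neg_mul_neg, h2, Equiv.sumCongr_apply, Sum.map_inl, Sum.map_inr,
      ← Complex.exp_conj, apply_ite conj, map_zero, EmbeddingLike.apply_eq_iff_eq]

theorem f_eq (x t : ℝ) :
    P.f x t = pfaffian (fun i j => P.mat x t i j) (pairedList (List.finRange (N + N))) := by
  rw [f, bullet_eq, pfaffian_map]
  rfl

/-- Conjugation relabels the pairs (a_j, b_j) simultaneously, which leaves the Pfaffian unchanged.
-/
theorem conj_f (x t : ℝ) : conj (P.f x t) = P.f x t := by
  rw [f_eq, conj_pfaffian]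
  simp only [conj_mat]
  rw [← pfaffian_map (fun i j => P.mat x t i j)]
  exact pfaffian_map_sumCongr (fun i j => P.entry_antisymm x t _ _) _ (List.nodup_finRange _)
    (List.mem_finRange)

/-! ### Generic invertibility -/

/-- The shift multiplies the block of the a_j by z = e^{2s} and changes nothing else. The
determinant is thus a polynomial in z, nonzero at z = 0, and s ↦ e^{2s} is injective on the reals,
so only finitely many s are excluded. -/
theorem dense_setOf_det_ne_zero (x t : ℝ) : Dense {s : ℝ | ((P.shift s).mat x t).det ≠ 0} := by
  open Polynomial in
  set A := (P.mat x t).toBlocks₁₁ with hA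
  set B := (P.mat x t).toBlocks₂₂ with hB
  have hmat (s : ℝ) : (P.shift s).mat x t =
      Matrix.fromBlocks (Complex.exp (2 * s) • A) 1 (-1) B := by
    ext i j
    rcases i with i | i <;> rcases j with j | j
    · simp only [mat, Matrix.of_apply, lbl, Sum.elim_inl, entry, η_shift, Matrix.fromBlocks_apply₁₁,
        Matrix.smul_apply, hA, Matrix.toBlocks₁₁, smul_eq_mul]
      have : P.η x t i + s + (P.η x t j + s) = 2 * s + (P.η x t i + P.η x t j) := by ring
      rw [this, Complex.exp_add]
      change (P.w j - P.w i) / (P.w j + P.w i) * _ = _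
      ring
    · simp [mat, lbl, entry, Matrix.one_apply]
    · simp [mat, lbl, entry, Matrix.one_apply, eq_comm]
    · rfl
  let R : Matrix (Fin (N + N) ⊕ Fin (N + N)) (Fin (N + N) ⊕ Fin (N + N)) ℂ[X] :=
    Matrix.fromBlocks ((X : ℂ[X]) • A.map C) 1 (-1) (B.map C)
  have hR (z : ℂ) : R.det.eval z = (Matrix.fromBlocks (z • A) 1 (-1) B).det := by
    rw [← coe_evalRingHom, RingHom.map_det]
    congr 1
    ext i j
    rcases i with i | i <;> rcases j with j | j
    · change eval z (X * C (A i j)) = z * A i j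
      rw [eval_mul, eval_X, eval_C]
    · simp [R, Matrix.one_apply, apply_ite (Polynomial.eval z)]
    · simp [R, Matrix.one_apply, apply_ite (Polynomial.eval z)]
    · simp [R]
  have hR0 : R.det ≠ 0 := by
    intro h
    have h0 := hR 0
    rw [h, eval_zero, zero_smul] at h0
    -- At z = 0 the matrix has an explicit inverse, whatever B is.
    have h1 : Matrix.fromBlocks 0 1 (-1) B * Matrix.fromBlocks B (-1) 1 0 = 1 := by
      simp [Matrix.fromBlocks_multiply]
    have h2 := congrArg Matrix.det h1
    rw [Matrix.det_mul, ← h0, zero_mul, Matrix.det_one] at h2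
    exact zero_ne_one h2
  have hfin : {s : ℝ | ((P.shift s).mat x t).det = 0}.Finite := by
    refine Set.Finite.subset (Set.Finite.preimage (f := fun s : ℝ => Complex.exp (2 * s)) ?_
      (R.det.roots.toFinset.finite_toSet)) ?_
    · intro s _ s' _ h
      have h' : Complex.exp ((2 * s : ℝ)) = Complex.exp ((2 * s' : ℝ)) := by
        push_cast
        exact h
      rw [← Complex.ofReal_exp, ← Complex.ofReal_exp, Complex.ofReal_inj, Real.exp_eq_exp] at h'
      linarith
    · intro s hs
      simp only [Set.mem_preimage, Finset.mem_coe, Multiset.mem_toFinset, mem_roots hR0, IsRoot.def,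
        hR, ← hmat]
      exact hs
  exact hfin.countable.dense_compl ℝ

end Params

namespace Params

open Function Filter Topology

variable {N : ℕ} {P : Params N}

/-! ### Derivatives of the entries -/

/-- The nonvanishing of the denominators, in terms of the `w_j`. -/
structure Regular (P : Params N) : Prop where
  σ_ne : P.σ ≠ 0
  p_ne : P.p ≠ 0
  w_ne : ∀ j, P.w j ≠ 0
  w_add_ne : ∀ j l, P.w j + P.w l ≠ 0
  p_sq_add_ne : ∀ j, (P.p : ℂ) ^ 2 + P.w j ^ 2 ≠ 0
  w_sq_ne : ∀ j l, sgn N j ≠ sgn N l → P.w j ^ 2 ≠ P.w l ^ 2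
  coupling_ne : ∀ j l, sgn N j ≠ sgn N l → P.coupling (P.w j) (P.w l) ≠ 0

/-- For w_j + w_l, indices from different halves are covered by `hkc`, equal indices by `hk`.
Conditions on the second half are conjugates of those on the first. -/
theorem regular_of_ne (hσ : P.σ ≠ 0) (hp : P.p ≠ 0) (hk : ∀ j, P.k j ≠ 0)
    (hkk : ∀ j l, j ≠ l → P.k j + P.k l ≠ 0) (hkc : ∀ j l, P.k j ^ 2 ≠ conj (P.k l) ^ 2)
    (hpk : ∀ j, (P.p : ℂ) ^ 2 + P.k j ^ 2 ≠ 0)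
    (hc : ∀ j l, P.coupling (P.k j) (conj (P.k l)) ≠ 0) : P.Regular where
  σ_ne := hσ
  p_ne := hp
  w_ne j := by
    refine Fin.addCases (fun j => ?_) (fun j => ?_) j
    · simpa [w] using hk j
    · simpa [w, -Fin.natAdd_eq_addNat] using hk j
  w_add_ne j l := by
    have h₁ : ∀ j l, P.k j + P.k l ≠ 0 := fun j l => by
      by_cases h : j = l
      · rw [h, ← two_mul]
        exact mul_ne_zero two_ne_zero (hk l)
      · exact hkk j l h
    have h₂ : ∀ j l, P.k j + conj (P.k l) ≠ 0 := fun j l h =>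
      hkc j l (by rw [eq_neg_of_add_eq_zero_left h, neg_sq])
    refine Fin.addCases (fun j => ?_) (fun j => ?_) j <;>
      refine Fin.addCases (fun l => ?_) (fun l => ?_) l <;>
      simp only [w, Fin.append_left, Fin.append_right]
    · exact h₁ j l
    · exact h₂ j l
    · rw [add_comm]
      exact h₂ l j
    · rw [← map_add]
      exact (map_ne_zero _).mpr (h₁ j l)
  p_sq_add_ne j := by
    refine Fin.addCases (fun j => ?_) (fun j => ?_) j
    · simpa [w] using hpk j
    · have := (map_ne_zero (starRingEnd ℂ)).mpr (hpk j)
      simpa [w, -Fin.natAdd_eq_addNat, Complex.conj_ofReal] using this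
  w_sq_ne j l := by
    refine Fin.addCases (fun j => ?_) (fun j => ?_) j <;>
      refine Fin.addCases (fun l => ?_) (fun l => ?_) l <;>
      simp only [w, sgn, Fin.append_left, Fin.append_right, ne_eq, not_true_eq_false,
        IsEmpty.forall_iff]
    · exact fun _ => hkc j l
    · exact fun _ h => hkc l j h.symm
  coupling_ne j l := by
    refine Fin.addCases (fun j => ?_) (fun j => ?_) j <;>
      refine Fin.addCases (fun l => ?_) (fun l => ?_) l <;>
      simp only [w, sgn, Fin.append_left, Fin.append_right, ne_eq, not_true_eq_false,
        IsEmpty.forall_iff]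
    · exact fun _ => hc j l
    · rw [coupling_comm]
      exact fun _ => hc l j

theorem Regular.shift (h : P.Regular) (s : ℝ) : (P.shift s).Regular :=
  ⟨h.σ_ne, h.p_ne, h.w_ne, h.w_add_ne, h.p_sq_add_ne, h.w_sq_ne, h.coupling_ne⟩

/-- The row of entries `(d_l, ·)`. -/
def dvec (P : Params N) (x t : ℝ) (l : ℤ) : Fin (N + N) ⊕ Fin (N + N) → ℂ :=
  fun i => P.entry x t (.d l) (lbl i)

theorem hasDerivAt_η_fst (P : Params N) (x t : ℝ) (j : Fin (N + N)) :
    HasDerivAt (fun x => P.η x t j) (P.w j) x := by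
  have h := (((hasDerivAt_id x).ofReal_comp.const_mul (P.w j)).add_const
    ((P.μ + P.lam) / P.w j * t)).add_const (P.η 0 0 j)
  simp only [Complex.ofReal_one, mul_one, id_eq] at h
  exact h.congr_of_eventuallyEq (Eventually.of_forall fun x => P.η_eq x t j)

theorem hasDerivAt_η_snd (P : Params N) (x t : ℝ) (j : Fin (N + N)) :
    HasDerivAt (fun t => P.η x t j) ((P.μ + P.lam) / P.w j) t := by
  have h := (((hasDerivAt_id t).ofReal_comp.const_mul ((P.μ + P.lam) / P.w j)).const_add
    (P.w j * x)).add_const (P.η 0 0 j)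
  simp only [Complex.ofReal_one, mul_one, id_eq] at h
  exact h.congr_of_eventuallyEq (Eventually.of_forall fun t => P.η_eq x t j)

/-- The factor w_j + w_l from the exponential cancels the denominator. What remains, w_l - w_j, is a
rank-two antisymmetric expression. -/
theorem hasDerivAt_mat_fst (hP : P.Regular) (x t : ℝ) (i j : Fin (N + N) ⊕ Fin (N + N)) :
    HasDerivAt (fun x => P.mat x t i j)
      (1 * (P.dvec x t 0 i * P.dvec x t 1 j - P.dvec x t 1 i * P.dvec x t 0 j)) x := by
  rcases i with i | i <;> rcases j with j | j <;>
    simp only [mat, dvec, Matrix.of_apply, lbl, Sum.elim_inl, Sum.elim_inr, entry, zero_mul,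
      mul_zero, sub_zero]
  · refine ((((P.hasDerivAt_η_fst x t i).add (P.hasDerivAt_η_fst x t j)).cexp).const_mul
      _).congr_deriv ?_
    have := hP.w_add_ne j i
    simp only [Pi.add_apply, Complex.exp_add]
    field_simp
    ring
  all_goals exact hasDerivAt_const x _

/-- Here the factor is (μ+λ)(w_j + w_l)/(w_j w_l), and (μ+λ)(1/w_j - 1/w_l) remains; this is where
the row d_{-1} enters. -/
theorem hasDerivAt_mat_snd (hP : P.Regular) (x t : ℝ) (i j : Fin (N + N) ⊕ Fin (N + N)) :
    HasDerivAt (fun t => P.mat x t i j)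
      ((P.μ + P.lam) *
        (P.dvec x t (-1) i * P.dvec x t 0 j - P.dvec x t 0 i * P.dvec x t (-1) j)) t := by
  rcases i with i | i <;> rcases j with j | j <;>
    simp only [mat, dvec, Matrix.of_apply, lbl, Sum.elim_inl, Sum.elim_inr, entry, zero_mul,
      mul_zero, sub_zero]
  · refine ((((P.hasDerivAt_η_snd x t i).add (P.hasDerivAt_η_snd x t j)).cexp).const_mul
      _).congr_deriv ?_
    have := hP.w_add_ne j i
    have := hP.w_ne i
    have := hP.w_ne j
    simp only [Pi.add_apply, Complex.exp_add, zpow_zero, zpow_neg_one]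
    field_simp
  all_goals exact hasDerivAt_const t _

theorem hasDerivAt_dvec_fst (hP : P.Regular) (x t : ℝ) (l : ℤ) (i : Fin (N + N) ⊕ Fin (N + N)) :
    HasDerivAt (fun x => P.dvec x t l i) (P.dvec x t (l + 1) i) x := by
  rcases i with i | i <;> simp only [dvec, lbl, Sum.elim_inl, Sum.elim_inr, entry]
  · refine (((P.hasDerivAt_η_fst x t i).cexp).const_mul _).congr_deriv ?_
    rw [zpow_add_one₀ (hP.w_ne i)]
    ring
  · exact hasDerivAt_const x _

theorem hasDerivAt_dvec_snd (hP : P.Regular) (x t : ℝ) (l : ℤ) (i : Fin (N + N) ⊕ Fin (N + N)) :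
    HasDerivAt (fun t => P.dvec x t l i) (((P.μ + P.lam : ℂ) • P.dvec x t (l - 1)) i) t := by
  rcases i with i | i <;>
    simp only [dvec, lbl, Sum.elim_inl, Sum.elim_inr, entry, Pi.smul_apply, smul_eq_mul, mul_zero]
  · refine (((P.hasDerivAt_η_snd x t i).cexp).const_mul _).congr_deriv ?_
    rw [zpow_sub_one₀ (hP.w_ne i)]
    ring
  · exact hasDerivAt_const t _

theorem continuous_mat (P : Params N) (i j : Fin (N + N) ⊕ Fin (N + N)) :
    Continuous fun q : ℝ × ℝ => P.mat q.1 q.2 i j :=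
  (P.contDiff_of_shift (n := 0) (F := fun P x t => P.mat x t i j)
    (P.contDiff_entry (lbl i) (lbl j))).continuous

theorem continuous_det_mat (P : Params N) :
    Continuous fun q : ℝ × ℝ => (P.mat q.1 q.2).det :=
  Continuous.matrix_det (continuous_pi fun i => continuous_pi fun j => P.continuous_mat i j)

theorem eventually_det_fst {x t : ℝ} (h : (P.mat x t).det ≠ 0) :
    ∀ᶠ y in 𝓝 x, (P.mat y t).det ≠ 0 :=
  (P.continuous_det_mat.comp (Continuous.prodMk_left t)).continuousAt.eventually_ne h

theorem eventually_det_snd {x t : ℝ} (h : (P.mat x t).det ≠ 0) :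
    ∀ᶠ y in 𝓝 t, (P.mat x y).det ≠ 0 :=
  (P.continuous_det_mat.comp (Continuous.prodMk_right x)).continuousAt.eventually_ne h

/-! ### The Pfaffians in terms of the inverse matrix -/

/-- A Pfaffian `(u, v, •)` in terms of the inverse of the matrix of `(•)`. -/
theorem pfaffian_cons_cons_bullet (P : Params N) {x t : ℝ} (hdet : (P.mat x t).det ≠ 0)
    (u v : Label (N + N)) :
    pfaffian (P.entry x t) (u :: v :: bullet N) =
      (P.entry x t u v - bracket (P.mat x t) (fun i => P.entry x t u (lbl i))
        (fun i => P.entry x t (lbl i) v)) * P.f x t := by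
  set M := P.mat x t with hM
  set y : Fin (N + N) ⊕ Fin (N + N) → ℂ := fun i => P.entry x t u (lbl i) with hy
  -- The coefficients solve My' = y; the minus sign appears because the elimination combines rows,
  -- whereas M acts on columns.
  rw [pfaffian_eliminate (P.entry_antisymm x t) lbl (fun k => -(M⁻¹.mulVec y) k) u v _
    lbl_mem_bullet, f]
  · rw [bracket_antisymm (P.mat_transpose x t), bracket, dotProduct]
    simp only [neg_mul, Finset.sum_neg_distrib]
    simp only [mul_comm, ← hM]
  · intro i hi
    obtain ⟨k, rfl⟩ := exists_lbl_of_mem_bullet hi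
    have h₁ : M.mulVec (M⁻¹.mulVec y) = y := by
      rw [Matrix.mulVec_mulVec, Matrix.mul_nonsing_inv _ hdet.isUnit, Matrix.one_mulVec]
    have h₂ := congrFun h₁ k
    rw [Matrix.mulVec, dotProduct] at h₂
    refine h₂.symm.trans (Finset.sum_congr rfl fun j _ => ?_)
    have : M k j = -P.entry x t (lbl j) (lbl k) := P.entry_antisymm x t _ _
    rw [this]
    ring

theorem pfaffian_d_d_bullet (P : Params N) {x t : ℝ} (hdet : (P.mat x t).det ≠ 0) (l m : ℤ) :
    pfaffian (P.entry x t) (.d l :: .d m :: bullet N) =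
      bracket (P.mat x t) (P.dvec x t l) (P.dvec x t m) * P.f x t := by
  rw [P.pfaffian_cons_cons_bullet hdet]
  have : (fun i => P.entry x t (lbl i) (.d m)) = (-1 : ℂ) • P.dvec x t m := by
    funext i
    rw [P.entry_antisymm, Pi.smul_apply, smul_eq_mul, neg_one_mul]
    rfl
  rw [this, bracket_smul_right]
  change (0 - -1 * bracket (P.mat x t) (P.dvec x t l) (P.dvec x t m)) * _ = _
  ring

theorem hasDerivAt_f_fst (hP : P.Regular) {x t : ℝ} (hdet : (P.mat x t).det ≠ 0) :
    HasDerivAt (fun x => P.f x t)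
      (-bracket (P.mat x t) (P.dvec x t 0) (P.dvec x t 1) * P.f x t) x := by
  refine (hasDerivAt_pfaffian (e := fun x => P.entry x t) (P.entry_antisymm x t) (.d 0) (.d 1) 1
    (bullet N) fun i hi j hj => ?_).congr_deriv ?_
  · obtain ⟨i, rfl⟩ := exists_lbl_of_mem_bullet hi
    obtain ⟨j, rfl⟩ := exists_lbl_of_mem_bullet hj
    exact hasDerivAt_mat_fst hP x t i j
  · rw [P.pfaffian_d_d_bullet hdet]
    simp [entry]

theorem hasDerivAt_f_snd (hP : P.Regular) {x t : ℝ} (hdet : (P.mat x t).det ≠ 0) :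
    HasDerivAt (fun t => P.f x t)
      (-((P.μ + P.lam) * bracket (P.mat x t) (P.dvec x t (-1)) (P.dvec x t 0)) * P.f x t) t := by
  refine (hasDerivAt_pfaffian (e := fun t => P.entry x t) (P.entry_antisymm x t) (.d (-1)) (.d 0)
    (P.μ + P.lam) (bullet N) fun i hi j hj => ?_).congr_deriv ?_
  · obtain ⟨i, rfl⟩ := exists_lbl_of_mem_bullet hi
    obtain ⟨j, rfl⟩ := exists_lbl_of_mem_bullet hj
    exact hasDerivAt_mat_snd hP x t i j
  · rw [P.pfaffian_d_d_bullet hdet]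
    simp [entry, mul_assoc]

/-! ### The bilinear equations at points of invertibility -/

theorem contDiff_f (P : Params N) : ContDiff ℝ ∞ (uncurry P.f) :=
  P.contDiff_of_shift P.contDiff_f_shift

theorem contDiff_g₁ (P : Params N) : ContDiff ℝ ∞ (uncurry P.g₁) :=
  P.contDiff_of_shift P.contDiff_g₁_shift

theorem contDiff_g₂ (P : Params N) : ContDiff ℝ ∞ (uncurry P.g₂) :=
  P.contDiff_of_shift P.contDiff_g₂_shift

/-- The bilinear equation for a function of the form `f (E - ⟨d_0, v⟩)`. -/
theorem hirota_one_one_of_bracket (hP : P.Regular) {g E Ex Et : ℝ → ℝ → ℂ}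
    {v : ℝ → ℝ → Fin (N + N) ⊕ Fin (N + N) → ℂ} (hg : ContDiff ℝ ∞ (uncurry g))
    (hgf : ∀ x t, (P.mat x t).det ≠ 0 →
      g x t = (E x t - bracket (P.mat x t) (P.dvec x t 0) (v x t)) * P.f x t)
    (hEx : ∀ x t, HasDerivAt (fun x => E x t) (Ex x t) x)
    (hEt : ∀ x t, HasDerivAt (fun t => E x t) (Et x t) t)
    (hEtx : ∀ x t, HasDerivAt (fun x => Et x t) ((P.μ + P.lam) * E x t) x)
    (hvx : ∀ x t i, HasDerivAt (fun x => v x t i) (((2 * Ex x t) • P.dvec x t 0) i) x)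
    (hvt : ∀ x t i, HasDerivAt (fun t => v x t i)
      (((2 * (P.μ + P.lam) * E x t) • P.dvec x t (-1)) i) t)
    {x t : ℝ} (hdet : (P.mat x t).det ≠ 0) :
    hirota 1 1 g P.f x t = (P.μ + P.lam) * g x t * P.f x t := by
  set c : ℂ := P.μ + P.lam with hc
  let br (l m : ℤ) (x t : ℝ) : ℂ := bracket (P.mat x t) (P.dvec x t l) (P.dvec x t m)
  let bv (l : ℤ) (x t : ℝ) : ℂ := bracket (P.mat x t) (P.dvec x t l) (v x t)
  have hanti (l m x t) : br l m x t = -br m l x t := bracket_antisymm (P.mat_transpose x t) _ _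
  have hself (l x t) : br l l x t = 0 := bracket_self (P.mat_transpose x t) _
  have hfx {x t} (h : (P.mat x t).det ≠ 0) :
      HasDerivAt (fun x => P.f x t) (-br 0 1 x t * P.f x t) x := hasDerivAt_f_fst hP h
  have hft {x t} (h : (P.mat x t).det ≠ 0) :
      HasDerivAt (fun t => P.f x t) (-(c * br (-1) 0 x t) * P.f x t) t := hasDerivAt_f_snd hP h
  have hbv {x t} (h : (P.mat x t).det ≠ 0) (l : ℤ) : HasDerivAt (fun x => bv l x t)
      (bv (l + 1) x t + 2 * Ex x t * br l 0 x t -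
        1 * (br l 0 x t * bv 1 x t - br l 1 x t * bv 0 x t)) x := by
    have := hasDerivAt_bracket_of_rank_two (hasDerivAt_mat_fst hP x t)
      (hasDerivAt_dvec_fst hP x t l) (hvx x t) h
    rwa [bracket_smul_right] at this
  have hbvt {x t} (h : (P.mat x t).det ≠ 0) : HasDerivAt (fun t => bv 0 x t)
      (c * bv (-1) x t + 2 * c * E x t * br 0 (-1) x t -
        c * (br 0 (-1) x t * bv 0 x t - br 0 0 x t * bv (-1) x t)) t := by
    have := hasDerivAt_bracket_of_rank_two (hasDerivAt_mat_snd hP x t)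
      (hasDerivAt_dvec_snd hP x t 0) (hvt x t) h
    rwa [bracket_smul_right, bracket_smul_left] at this
  have hm {x t} (h : (P.mat x t).det ≠ 0) : HasDerivAt (fun x => br (-1) 0 x t)
      (br 0 0 x t + br (-1) 1 x t -
        1 * (br (-1) 0 x t * br 1 0 x t - br (-1) 1 x t * br 0 0 x t)) x :=
    hasDerivAt_bracket_of_rank_two (hasDerivAt_mat_fst hP x t)
      (hasDerivAt_dvec_fst hP x t (-1)) (hasDerivAt_dvec_fst hP x t 0) h
  have hgx : dx g x t = P.f x t * (Ex x t - bv 1 x t - br 0 1 x t * E x t) := by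
    have h₁ : (fun x => g x t) =ᶠ[𝓝 x] fun x => (E x t - bv 0 x t) * P.f x t := by
      filter_upwards [eventually_det_fst hdet] with y hy using hgf y t hy
    rw [dx, h₁.deriv_eq]
    refine ((((hEx x t).sub (hbv hdet 0)).mul (hfx hdet)).deriv).trans ?_
    simp only [hself, zero_add, Pi.sub_apply]
    ring
  have hgt {x t} (h : (P.mat x t).det ≠ 0) :
      dt g x t = P.f x t * (Et x t - c * bv (-1) x t + c * br (-1) 0 x t * E x t) := by
    have h₁ : (fun t => g x t) =ᶠ[𝓝 t] fun t => (E x t - bv 0 x t) * P.f x t := by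
      filter_upwards [eventually_det_snd h] with y hy using hgf x y hy
    rw [dt, h₁.deriv_eq]
    refine ((((hEt x t).sub (hbvt h)).mul (hft h)).deriv).trans ?_
    simp only [hself, hanti 0 (-1), Pi.sub_apply]
    ring
  have hgtx : dx (dt g) x t = -br 0 1 x t * P.f x t *
      (Et x t - c * bv (-1) x t + c * br (-1) 0 x t * E x t) + P.f x t *
      (c * E x t - c * (bv 0 x t + 2 * Ex x t * br (-1) 0 x t -
        (br (-1) 0 x t * bv 1 x t - br (-1) 1 x t * bv 0 x t)) +
        (c * (br (-1) 1 x t + br (-1) 0 x t * br 0 1 x t) * E x t +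
        c * br (-1) 0 x t * Ex x t)) := by
    have h₁ : (fun x => dt g x t) =ᶠ[𝓝 x]
        fun x => P.f x t * (Et x t - c * bv (-1) x t + c * br (-1) 0 x t * E x t) := by
      filter_upwards [eventually_det_fst hdet] with y hy using hgt hy
    rw [dx, h₁.deriv_eq]
    refine (((hfx hdet).mul (((hEtx x t).sub ((hbv hdet (-1)).const_mul c)).add
      (((hm hdet).const_mul c).mul (hEx x t)))).deriv).trans ?_
    simp only [hself, hanti 1 0, Int.reduceNeg, Int.reduceAdd, Pi.add_apply, Pi.sub_apply,
      Pi.mul_apply]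
    ring
  have hftx : dx (dt P.f) x t = -c * br (-1) 1 x t * P.f x t := by
    have h₁ : (fun x => dt P.f x t) =ᶠ[𝓝 x] fun x => -(c * br (-1) 0 x t) * P.f x t := by
      filter_upwards [eventually_det_fst hdet] with y hy using (hft hy).deriv
    rw [dx, h₁.deriv_eq]
    refine ((((hm hdet).const_mul c).neg.mul (hfx hdet)).deriv).trans ?_
    simp only [hself, hanti 1 0, Pi.neg_apply]
    ring
  have hf₁ : dx P.f x t = -br 0 1 x t * P.f x t := (hfx hdet).deriv
  have hf₂ : dt P.f x t = -(c * br (-1) 0 x t) * P.f x t := (hft hdet).deriv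
  have hg₀ : g x t = (E x t - bv 0 x t) * P.f x t := hgf x t hdet
  -- What is left is a polynomial identity in f, E, its derivatives and the brackets; antisymmetry
  -- is the only relation between brackets that has been used.
  rw [hirota_one_one hg P.contDiff_f, hgtx, hftx, hgx, hgt hdet, hf₁, hf₂, hg₀]
  ring

/-! ### The auxiliary columns and the bilinear equations -/

/-- The column of entries `(·, β)`. -/
def βvec (N : ℕ) : Fin (N + N) ⊕ Fin (N + N) → ℂ :=
  Sum.elim (fun _ => 0) fun j => (1 + sgn N j) / 2

/-- The column of entries `(·, γ)`. -/
def γvec (P : Params N) (x t : ℝ) : Fin (N + N) ⊕ Fin (N + N) → ℂ :=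
  Sum.elim (fun j => 2 * Complex.I * P.p / (P.w j + Complex.I * P.p) * Complex.exp (P.η x t j))
    fun _ => 0

/-- The complex conjugate of `βvec`, with `j` and `N + j` exchanged. -/
def βvecConj (N : ℕ) : Fin (N + N) ⊕ Fin (N + N) → ℂ :=
  Sum.elim (fun _ => 0) fun j => (1 - sgn N j) / 2

/-- The complex conjugate of `γvec`, with `j` and `N + j` exchanged. -/
def γvecConj (P : Params N) (x t : ℝ) : Fin (N + N) ⊕ Fin (N + N) → ℂ :=
  Sum.elim (fun j => -2 * Complex.I * P.p / (P.w j - Complex.I * P.p) * Complex.exp (P.η x t j))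
    fun _ => 0

theorem Regular.w_add_I_mul_ne (hP : P.Regular) (j : Fin (N + N)) :
    P.w j + Complex.I * P.p ≠ 0 := fun h => hP.p_sq_add_ne j <| by
  linear_combination (P.w j - Complex.I * P.p) * h + (P.p : ℂ) ^ 2 * Complex.I_sq

theorem Regular.w_sub_I_mul_ne (hP : P.Regular) (j : Fin (N + N)) :
    P.w j - Complex.I * P.p ≠ 0 := fun h => hP.p_sq_add_ne j <| by
  linear_combination (P.w j + Complex.I * P.p) * h + (P.p : ℂ) ^ 2 * Complex.I_sq

theorem g₁_eq {x t : ℝ} (hdet : (P.mat x t).det ≠ 0) :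
    P.g₁ x t = (0 - bracket (P.mat x t) (P.dvec x t 0) (βvec N)) * P.f x t := by
  rw [g₁, P.pfaffian_cons_cons_bullet hdet]
  have : (fun i => P.entry x t (lbl i) .beta) = βvec N := by
    funext i
    rcases i with i | i <;> rfl
  rw [this]
  rfl

theorem g₂_eq {x t : ℝ} (hdet : (P.mat x t).det ≠ 0) :
    P.g₂ x t = P.r * Complex.exp (Complex.I * P.φ x t) *
      ((1 - bracket (P.mat x t) (P.dvec x t 0) (P.γvec x t)) * P.f x t) := by
  rw [g₂, P.pfaffian_cons_cons_bullet hdet]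
  have : (fun i => P.entry x t (lbl i) .gamma) = P.γvec x t := by
    funext i
    rcases i with i | i <;> rfl
  rw [this]
  simp only [entry, if_true]
  rfl

/-- The column β is constant and (d_0, β) = 0, so E = 0. -/
theorem hirota_g₁ (hP : P.Regular) {x t : ℝ} (hdet : (P.mat x t).det ≠ 0) :
    hirota 1 1 P.g₁ P.f x t = (P.μ + P.lam) * P.g₁ x t * P.f x t := by
  refine hirota_one_one_of_bracket hP (E := fun _ _ => 0) (Ex := fun _ _ => 0)
    (Et := fun _ _ => 0) (v := fun _ _ => βvec N) P.contDiff_g₁ (fun x t h => g₁_eq h)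
    (fun x t => hasDerivAt_const _ _) (fun x t => hasDerivAt_const _ _) (fun x t => ?_)
    (fun x t i => ?_) (fun x t i => ?_) hdet
  · rw [mul_zero]
    exact hasDerivAt_const _ _
  · rw [mul_zero, zero_smul]
    exact hasDerivAt_const _ _
  · rw [mul_zero, zero_smul]
    exact hasDerivAt_const _ _

/-- With E = re^{iφ} and v = Eγ, both derivatives of Ee^{η_j} contain the factor w_j + ip, which
cancels the denominator of γ. Moreover (ip)(-i(μ+λ)/p) = μ+λ. -/
theorem hirota_g₂ (hP : P.Regular) {x t : ℝ} (hdet : (P.mat x t).det ≠ 0) :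
    hirota 1 1 P.g₂ P.f x t = (P.μ + P.lam) * P.g₂ x t * P.f x t := by
  have hp : (P.p : ℂ) ≠ 0 := by exact_mod_cast hP.p_ne
  let E : ℝ → ℝ → ℂ := fun x t => P.r * Complex.exp (Complex.I * P.φ x t)
  have hEx (x t) : HasDerivAt (fun x => E x t) (Complex.I * P.p * E x t) x := by
    have hφ : HasDerivAt (fun x => P.φ x t) P.p x := by
      have := ((((hasDerivAt_id x).const_mul P.p).sub_const
        ((P.μ + P.lam) / P.p * t)).add_const P.φ₀)
      rwa [mul_one] at this
    refine (((hφ.ofReal_comp.const_mul Complex.I).cexp).const_mul (P.r : ℂ)).congr_deriv ?_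
    simp only [E]
    ring
  have hEt (x t) : HasDerivAt (fun t => E x t)
      (-(Complex.I * ((P.μ + P.lam) / P.p)) * E x t) t := by
    have hφ : HasDerivAt (fun t => P.φ x t) (-((P.μ + P.lam) / P.p)) t := by
      have := ((((hasDerivAt_id t).const_mul ((P.μ + P.lam) / P.p)).const_sub
        (P.p * x)).add_const P.φ₀)
      rwa [mul_one] at this
    refine (((hφ.ofReal_comp.const_mul Complex.I).cexp).const_mul (P.r : ℂ)).congr_deriv ?_
    simp only [E]
    push_cast
    ring
  refine hirota_one_one_of_bracket hP (E := E) (Ex := fun x t => Complex.I * P.p * E x t)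
    (Et := fun x t => -(Complex.I * ((P.μ + P.lam) / P.p)) * E x t)
    (v := fun x t => E x t • P.γvec x t) P.contDiff_g₂ (fun x t h => ?_) hEx hEt
    (fun x t => ?_) (fun x t i => ?_) (fun x t i => ?_) hdet
  · rw [g₂_eq h, bracket_smul_right]
    simp only [E]
    ring
  · refine ((hEx x t).const_mul _).congr_deriv ?_
    field_simp
    linear_combination -(P.μ + P.lam : ℂ) * E x t * Complex.I_sq
  · rcases i with i | i <;>
      simp only [dvec, lbl, γvec, Sum.elim_inl, Sum.elim_inr, entry, Pi.smul_apply, smul_eq_mul,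
        mul_zero]
    · refine ((hEx x t).mul (((P.hasDerivAt_η_fst x t i).cexp).const_mul _)).congr_deriv ?_
      have := hP.w_add_I_mul_ne i
      field_simp
      ring
    · exact hasDerivAt_const _ _
  · rcases i with i | i <;>
      simp only [dvec, lbl, γvec, Sum.elim_inl, Sum.elim_inr, entry, Pi.smul_apply, smul_eq_mul,
        mul_zero]
    · refine ((hEt x t).mul (((P.hasDerivAt_η_snd x t i).cexp).const_mul _)).congr_deriv ?_
      have := hP.w_add_I_mul_ne i
      have := hP.w_ne i
      rw [zpow_neg_one]
      field_simp
      ring_nf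
      rw [Complex.I_sq]
      ring
    · exact hasDerivAt_const _ _

/-! ### Conjugation of brackets and the quadratic relation -/

theorem conj_dvec_zero (x t : ℝ) (i : Fin (N + N) ⊕ Fin (N + N)) :
    conj (P.dvec x t 0 i) = P.dvec x t 0 (Equiv.sumCongr (conjPerm N) (conjPerm N) i) := by
  rcases i with i | i <;>
    simp [dvec, lbl, entry, η_conjPerm, ← Complex.exp_conj]

/-- Both M and the row d_0 are invariant under conjugation combined with the exchange of j and N+j,
so only the column changes. -/
theorem conj_bracket_dvec_zero {x t : ℝ} (hdet : (P.mat x t).det ≠ 0)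
    {v v' : Fin (N + N) ⊕ Fin (N + N) → ℂ}
    (h : ∀ i, conj (v i) = v' (Equiv.sumCongr (conjPerm N) (conjPerm N) i)) :
    conj (bracket (P.mat x t) (P.dvec x t 0) v) = bracket (P.mat x t) (P.dvec x t 0) v' := by
  rw [conj_bracket (Equiv.sumCongr (conjPerm N) (conjPerm N)) hdet (P.conj_mat x t)]
  simp only [conj_dvec_zero, h, Equiv.apply_symm_apply]

theorem conj_βvec (i : Fin (N + N) ⊕ Fin (N + N)) :
    conj (βvec N i) = βvecConj N (Equiv.sumCongr (conjPerm N) (conjPerm N) i) := by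
  rcases i with i | i <;>
    simp [βvec, βvecConj, sgn_conjPerm, conj_sgn, Complex.conj_ofNat]

theorem conj_γvec (x t : ℝ) (i : Fin (N + N) ⊕ Fin (N + N)) :
    conj (P.γvec x t i) = P.γvecConj x t (Equiv.sumCongr (conjPerm N) (conjPerm N) i) := by
  rcases i with i | i <;>
    simp [γvec, γvecConj, w_conjPerm, η_conjPerm, Complex.conj_ofNat, Complex.conj_ofReal,
      ← Complex.exp_conj, sub_eq_add_neg]

/-- Over the denominator p² + w_j², shared with the conjugate column, the sum of the two columns is
visibly 4p²/(p² + w_j²) times d_0. -/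
theorem γvec_inl (hP : P.Regular) (x t : ℝ) (j : Fin (N + N)) :
    P.γvec x t (.inl j) = 2 * P.p * (Complex.I * P.w j + P.p) / (P.p ^ 2 + P.w j ^ 2) *
      Complex.exp (P.η x t j) := by
  rw [γvec, Sum.elim_inl]
  congr 1
  rw [div_eq_div_iff (hP.w_add_I_mul_ne j) (hP.p_sq_add_ne j)]
  linear_combination -2 * P.p ^ 2 * P.w j * Complex.I_sq

theorem γvecConj_inl (hP : P.Regular) (x t : ℝ) (j : Fin (N + N)) :
    P.γvecConj x t (.inl j) = 2 * P.p * (-Complex.I * P.w j + P.p) / (P.p ^ 2 + P.w j ^ 2) *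
      Complex.exp (P.η x t j) := by
  rw [γvecConj, Sum.elim_inl]
  congr 1
  rw [div_eq_div_iff (hP.w_sub_I_mul_ne j) (hP.p_sq_add_ne j)]
  linear_combination -2 * P.p ^ 2 * P.w j * Complex.I_sq

/-- The quadratic relation behind the third bilinear equation. -/
theorem bracket_relation (hP : P.Regular) {x t : ℝ} (hdet : (P.mat x t).det ≠ 0) :
    2 * (bracket (P.mat x t) (P.dvec x t 0) (P.dvec x t 2) +
        bracket (P.mat x t) (P.dvec x t 0) (P.dvec x t 1) ^ 2) =
      P.σ * (P.r ^ 2 * (bracket (P.mat x t) (P.dvec x t 0) (P.γvec x t) +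
          bracket (P.mat x t) (P.dvec x t 0) (P.γvecConj x t) -
          bracket (P.mat x t) (P.dvec x t 0) (P.γvec x t) *
            bracket (P.mat x t) (P.dvec x t 0) (P.γvecConj x t)) -
        bracket (P.mat x t) (P.dvec x t 0) (βvec N) *
          bracket (P.mat x t) (P.dvec x t 0) (βvecConj N)) := by
  have hσ : (P.σ : ℂ) ≠ 0 := by exact_mod_cast hP.σ_ne
  let u : Fin (N + N) → ℂ := fun j => P.p ^ 2 + P.w j ^ 2
  -- This h makes h_i - h_j equal to (w_i² - w_j²) times the coupling, cancelling the denominator of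
  -- (b_i, b_j). It agrees on a_j and b_j, so the unit entries (a_j, b_j) drop out.
  let h : Fin (N + N) ⊕ Fin (N + N) → ℂ := fun i =>
    2 / P.σ * u (Sum.elim id id i) - 4 * P.p ^ 2 * P.r ^ 2 / u (Sum.elim id id i)
  have hdiff (i j) : 2 * (P.w i ^ 2 - P.w j ^ 2) * P.coupling (P.w i) (P.w j) =
      2 * (h (.inr i) - h (.inr j)) := by
    have h₁ := hP.p_sq_add_ne i
    have h₂ := hP.p_sq_add_ne j
    simp only [h, u, coupling, Sum.elim_inr, id]
    field_simp
    ring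
  -- In the block of the a_j, the terms in d_0, d_1, d_2 give -(2/σ)(w_i - w_j)² and those with r²
  -- give -4p²r²(w_i - w_j)²/(u_i u_j), each times the exponentials. The β terms give (1 - μ_iμ_j)/2
  -- in the block of the b_j.
  have key := bracket_quadratic (P.mat_transpose x t) hdet h (P.dvec x t 0)
    ![P.dvec x t 1, P.dvec x t 0, P.dvec x t 2, P.γvec x t, P.γvecConj x t,
      P.γvec x t + P.γvecConj x t, P.dvec x t 0, βvec N, βvecConj N]
    ![P.dvec x t 1, P.dvec x t 2, P.dvec x t 0, P.γvecConj x t, P.γvec x t,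
      P.dvec x t 0, P.γvec x t + P.γvecConj x t, βvecConj N, βvec N]
    ![4 / (P.σ : ℂ), -2 / P.σ, -2 / P.σ, (P.r : ℂ) ^ 2, (P.r : ℂ) ^ 2, -(P.r : ℂ) ^ 2,
      -(P.r : ℂ) ^ 2, 1, 1] ?_
  -- The r² part of h d_0 is -r²(γ + conjugate column); the multiple of d_0 will drop out since
  -- ⟨d_0, d_0⟩ = 0.
  · have hu : (fun i => h i * P.dvec x t 0 i) = (2 / P.σ : ℂ) • P.dvec x t 2 +
        ((2 / P.σ * P.p ^ 2 : ℂ) • P.dvec x t 0 +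
        (-(P.r : ℂ) ^ 2) • (P.γvec x t + P.γvecConj x t)) := by
      funext i
      rcases i with i | i
      · have h₁ := hP.p_sq_add_ne i
        simp only [Pi.add_apply, Pi.smul_apply, smul_eq_mul, γvec_inl hP, γvecConj_inl hP, dvec,
          lbl, Sum.elim_inl, entry, h, u, id, zpow_ofNat]
        field_simp
        ring
      · simp [dvec, lbl, γvec, γvecConj, entry]
    rw [hu] at key
    simp only [Fin.sum_univ_succ, bracket_add_right, bracket_smul_right,
      bracket_self (P.mat_transpose x t)] at key
    simp [bracket_add_right, bracket_self (P.mat_transpose x t)] at key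
    field_simp at key ⊢
    linear_combination key / 2
  · simp only [Fin.sum_univ_succ, Fin.sum_univ_zero, Matrix.cons_val_zero, Matrix.cons_val_succ,
      Pi.add_apply, add_zero]
    rintro (i | i) (j | j)
    · have hij : h (.inl i) - h (.inl j) =
          (P.w i ^ 2 - P.w j ^ 2) * P.coupling (P.w i) (P.w j) := by
        have e : 2 * (h (.inl i) - h (.inl j)) =
          2 * (P.w i ^ 2 - P.w j ^ 2) * P.coupling (P.w i) (P.w j) := (hdiff i j).symm
        linear_combination e / 2
      have h₁ := hP.p_sq_add_ne i
      have h₂ := hP.p_sq_add_ne j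
      have h₃ := hP.w_add_ne j i
      have h₄ : (h (.inl i) - h (.inl j)) * P.mat x t (.inl i) (.inl j) =
          -((P.w i - P.w j) ^ 2 * P.coupling (P.w i) (P.w j)) *
            (Complex.exp (P.η x t i) * Complex.exp (P.η x t j)) := by
        rw [hij]
        simp only [mat, Matrix.of_apply, lbl, Sum.elim_inl, entry, Complex.exp_add]
        field_simp
        ring
      rw [h₄]
      simp only [γvec_inl hP, γvecConj_inl hP, dvec, lbl, Sum.elim_inl, entry, βvec, βvecConj,
        zpow_ofNat, mul_zero, add_zero, coupling]
      field_simp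
      ring_nf
      rw [Complex.I_sq]
      ring
    · by_cases hij : i = j
      · simp [h, hij, dvec, lbl, entry, βvec, βvecConj, γvec, γvecConj]
      · simp [hij, mat, dvec, lbl, entry, βvec, βvecConj, γvec, γvecConj]
    · by_cases hij : j = i
      · simp [h, hij, dvec, lbl, entry, βvec, βvecConj, γvec, γvecConj]
      · simp [hij, mat, dvec, lbl, entry, βvec, βvecConj, γvec, γvecConj]
    · have hss : (h (.inr i) - h (.inr j)) * P.mat x t (.inr i) (.inr j) =
          (1 - sgn N i * sgn N j) / 2 := by
        simp only [mat, Matrix.of_apply, lbl, Sum.elim_inr, entry]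
        -- For equal signs both sides vanish; for opposite signs h_i - h_j is nonzero and cancels.
        by_cases hij : sgn N i = sgn N j
        · have : sgn N j * sgn N j = 1 := by
            refine Fin.addCases (fun j => ?_) (fun j => ?_) j <;>
              simp [sgn, -Fin.natAdd_eq_addNat]
          simp [hij, this]
        · have h₁ : h (.inr i) - h (.inr j) ≠ 0 := by
            intro e
            have := hdiff i j
            rw [e, mul_zero] at this
            exact mul_ne_zero (mul_ne_zero two_ne_zero (sub_ne_zero.mpr (hP.w_sq_ne i j hij)))
              (hP.coupling_ne i j hij) this
          rw [hdiff]
          field_simp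
      rw [hss]
      simp only [dvec, lbl, Sum.elim_inr, entry, βvec, βvecConj, γvec, γvecConj]
      ring

theorem hirota_f (hP : P.Regular) {x t : ℝ} (hdet : (P.mat x t).det ≠ 0) :
    hirota 2 0 P.f P.f x t + P.r ^ 2 * P.σ * (P.f x t * P.f x t) =
      P.σ * ((‖P.g₁ x t‖ : ℂ) ^ 2 + (‖P.g₂ x t‖ : ℂ) ^ 2) := by
  have hself (l) {x t} : bracket (P.mat x t) (P.dvec x t l) (P.dvec x t l) = 0 :=
    bracket_self (P.mat_transpose x t) _
  have hf₁ {x t} (h : (P.mat x t).det ≠ 0) : dx P.f x t =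
      -bracket (P.mat x t) (P.dvec x t 0) (P.dvec x t 1) * P.f x t := (hasDerivAt_f_fst hP h).deriv
  -- The square of ⟨d_0, d_1⟩ produced by the variation of M cancels the one coming from f_x, and
  -- ⟨d_1, d_1⟩ = 0.
  have hf₂ : dx (dx P.f) x t =
      -bracket (P.mat x t) (P.dvec x t 0) (P.dvec x t 2) * P.f x t := by
    have h₁ : (fun x => dx P.f x t) =ᶠ[𝓝 x]
        fun x => -bracket (P.mat x t) (P.dvec x t 0) (P.dvec x t 1) * P.f x t := by
      filter_upwards [eventually_det_fst hdet] with y hy using hf₁ hy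
    have h₂ := hasDerivAt_bracket_of_rank_two (hasDerivAt_mat_fst hP x t)
      (hasDerivAt_dvec_fst hP x t 0) (hasDerivAt_dvec_fst hP x t 1) hdet
    rw [dx, h₁.deriv_eq]
    refine ((h₂.neg.mul (hasDerivAt_f_fst hP hdet)).deriv).trans ?_
    simp only [zero_add, Int.reduceAdd, hself, Pi.neg_apply]
    ring
  have n₁ : (‖P.g₁ x t‖ : ℂ) ^ 2 = bracket (P.mat x t) (P.dvec x t 0) (βvec N) *
      bracket (P.mat x t) (P.dvec x t 0) (βvecConj N) * P.f x t ^ 2 := by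
    rw [← Complex.mul_conj', g₁_eq hdet, map_mul, map_sub,
      conj_bracket_dvec_zero hdet conj_βvec, conj_f, map_zero]
    ring
  have hE : Complex.exp (Complex.I * P.φ x t) * conj (Complex.exp (Complex.I * P.φ x t)) = 1 := by
    rw [← Complex.exp_conj, ← Complex.exp_add, map_mul, Complex.conj_I, Complex.conj_ofReal,
      neg_mul, add_neg_cancel, Complex.exp_zero]
  have n₂ : (‖P.g₂ x t‖ : ℂ) ^ 2 = P.r ^ 2 *
      ((1 - bracket (P.mat x t) (P.dvec x t 0) (P.γvec x t)) *
      (1 - bracket (P.mat x t) (P.dvec x t 0) (P.γvecConj x t))) * P.f x t ^ 2 := by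
    rw [← Complex.mul_conj', g₂_eq hdet, map_mul, map_mul, map_mul, map_sub,
      conj_bracket_dvec_zero hdet (conj_γvec x t),
      conj_f, map_one, Complex.conj_ofReal]
    linear_combination P.r ^ 2 *
      ((1 - bracket (P.mat x t) (P.dvec x t 0) (P.γvec x t)) *
      (1 - bracket (P.mat x t) (P.dvec x t 0) (P.γvecConj x t))) * P.f x t ^ 2 * hE
  rw [hirota_two_zero P.contDiff_f, hf₂, hf₁ hdet, n₁, n₂]
  linear_combination -P.f x t ^ 2 * bracket_relation hP hdet

/-! ### The bilinear equations everywhere -/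

theorem continuous_of_param {F : ℝ → ℝ → ℝ → ℂ}
    (h : ContDiff ℝ ∞ fun q : ℝ × ℝ × ℝ => F q.1 q.2.1 q.2.2) (x t : ℝ) :
    Continuous fun s => F s x t :=
  h.continuous.comp (Continuous.prodMk_left (x, t))

theorem continuous_hirota_one_one {f g : ℝ → ℝ → ℝ → ℂ}
    (hf : ContDiff ℝ ∞ fun q : ℝ × ℝ × ℝ => f q.1 q.2.1 q.2.2)
    (hg : ContDiff ℝ ∞ fun q : ℝ × ℝ × ℝ => g q.1 q.2.1 q.2.2) (x t : ℝ) :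
    Continuous fun s => hirota 1 1 (f s) (g s) x t := by
  have slice {F : ℝ → ℝ → ℝ → ℂ} (h : ContDiff ℝ ∞ fun q : ℝ × ℝ × ℝ => F q.1 q.2.1 q.2.2)
      (s : ℝ) : ContDiff ℝ ∞ (uncurry (F s)) := h.comp (contDiff_const.prodMk contDiff_id)
  have hx {F : ℝ → ℝ → ℝ → ℂ} (h : ContDiff ℝ ∞ fun q : ℝ × ℝ × ℝ => F q.1 q.2.1 q.2.2) :
      ContDiff ℝ ∞ fun q : ℝ × ℝ × ℝ => dx (F q.1) q.2.1 q.2.2 :=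
    contDiff_iff_contDiffAt.mpr fun _ => contDiffAt_param_dx h.contDiffAt
  have ht {F : ℝ → ℝ → ℝ → ℂ} (h : ContDiff ℝ ∞ fun q : ℝ × ℝ × ℝ => F q.1 q.2.1 q.2.2) :
      ContDiff ℝ ∞ fun q : ℝ × ℝ × ℝ => dt (F q.1) q.2.1 q.2.2 :=
    contDiff_iff_contDiffAt.mpr fun _ => contDiffAt_param_dt h.contDiffAt
  have e (s) := hirota_one_one (slice hf s) (slice hg s) x t
  simp only [e]
  have c {F : ℝ → ℝ → ℝ → ℂ} (h : ContDiff ℝ ∞ fun q : ℝ × ℝ × ℝ => F q.1 q.2.1 q.2.2) :=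
    continuous_of_param h x t
  exact ((((c (hx (F := fun s => dt (f s)) (ht hf))).mul (c hg)).add
    ((c hf).mul (c (hx (F := fun s => dt (g s)) (ht hg))))).sub
    ((c (F := fun s => dx (f s)) (hx hf)).mul (c (F := fun s => dt (g s)) (ht hg)))).sub
    ((c (F := fun s => dt (f s)) (ht hf)).mul (c (F := fun s => dx (g s)) (hx hg)))

theorem continuous_hirota_two_zero {f : ℝ → ℝ → ℝ → ℂ}
    (hf : ContDiff ℝ ∞ fun q : ℝ × ℝ × ℝ => f q.1 q.2.1 q.2.2) (x t : ℝ) :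
    Continuous fun s => hirota 2 0 (f s) (f s) x t := by
  have slice (s : ℝ) : ContDiff ℝ ∞ (uncurry (f s)) :=
    hf.comp (contDiff_const.prodMk contDiff_id)
  have hx {F : ℝ → ℝ → ℝ → ℂ} (h : ContDiff ℝ ∞ fun q : ℝ × ℝ × ℝ => F q.1 q.2.1 q.2.2) :
      ContDiff ℝ ∞ fun q : ℝ × ℝ × ℝ => dx (F q.1) q.2.1 q.2.2 :=
    contDiff_iff_contDiffAt.mpr fun _ => contDiffAt_param_dx h.contDiffAt
  have e (s) := hirota_two_zero (slice s) x t
  simp only [e]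
  exact continuous_const.mul (((continuous_of_param hf x t).mul
    (continuous_of_param (F := fun s => dx (dx (f s))) (hx (F := fun s => dx (f s)) (hx hf)) x
      t)).sub ((continuous_of_param (F := fun s => dx (f s)) (hx hf) x t).pow 2))

/-- For fixed (x,t) both sides are continuous in the phase shift s and agree for the dense set of s
with invertible matrix; s = 0 gives the claim. -/
theorem bilinear_equations (hP : P.Regular) (x t : ℝ) :
    hirota 1 1 P.g₁ P.f x t = (P.μ + P.lam) * P.g₁ x t * P.f x t ∧
      hirota 1 1 P.g₂ P.f x t = (P.μ + P.lam) * P.g₂ x t * P.f x t ∧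
      hirota 2 0 P.f P.f x t + P.r ^ 2 * P.σ * (P.f x t * P.f x t) =
        P.σ * ((‖P.g₁ x t‖ : ℂ) ^ 2 + (‖P.g₂ x t‖ : ℂ) ^ 2) := by
  have hD := P.dense_setOf_det_ne_zero x t
  have cf := continuous_of_param (F := fun s => (P.shift s).f) P.contDiff_f_shift x t
  have cg₁ := continuous_of_param (F := fun s => (P.shift s).g₁) P.contDiff_g₁_shift x t
  have cg₂ := continuous_of_param (F := fun s => (P.shift s).g₂) P.contDiff_g₂_shift x t
  have c₁ := continuous_hirota_one_one (f := fun s => (P.shift s).g₁) (g := fun s => (P.shift s).f)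
    P.contDiff_g₁_shift P.contDiff_f_shift x t
  have c₂ := continuous_hirota_one_one (f := fun s => (P.shift s).g₂) (g := fun s => (P.shift s).f)
    P.contDiff_g₂_shift P.contDiff_f_shift x t
  have c₃ := continuous_hirota_two_zero (f := fun s => (P.shift s).f) P.contDiff_f_shift x t
  have k₁ : (fun s => hirota 1 1 (P.shift s).g₁ (P.shift s).f x t) =
      fun s => (P.μ + P.lam : ℂ) * (P.shift s).g₁ x t * (P.shift s).f x t :=
    Continuous.ext_on hD c₁ ((continuous_const.mul cg₁).mul cf)
      fun s hs => hirota_g₁ (hP.shift s) hs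
  have k₂ : (fun s => hirota 1 1 (P.shift s).g₂ (P.shift s).f x t) =
      fun s => (P.μ + P.lam : ℂ) * (P.shift s).g₂ x t * (P.shift s).f x t :=
    Continuous.ext_on hD c₂ ((continuous_const.mul cg₂).mul cf)
      fun s hs => hirota_g₂ (hP.shift s) hs
  have k₃ : (fun s => hirota 2 0 (P.shift s).f (P.shift s).f x t +
      (P.r : ℂ) ^ 2 * P.σ * ((P.shift s).f x t * (P.shift s).f x t)) =
      fun s => (P.σ : ℂ) *
        ((‖(P.shift s).g₁ x t‖ : ℂ) ^ 2 + (‖(P.shift s).g₂ x t‖ : ℂ) ^ 2) :=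
    Continuous.ext_on hD (c₃.add (continuous_const.mul (cf.mul cf)))
      (continuous_const.mul (((Complex.continuous_ofReal.comp cg₁.norm).pow 2).add
        ((Complex.continuous_ofReal.comp cg₂.norm).pow 2)))
      fun s hs => hirota_f (hP.shift s) hs
  have e₁ := congrFun k₁ 0
  have e₂ := congrFun k₂ 0
  have e₃ := congrFun k₃ 0
  simp only [shift_zero] at e₁ e₂ e₃
  exact ⟨e₁, e₂, e₃⟩

end Params

end ABSystem

end

/-! ### The main theorem -/

theorem theorem1 {N : ℕ} (P : ABSystem.Params N)
    (hσ : P.σ ≠ 0) (hp : P.p ≠ 0)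
    (hk : ∀ j, P.k j ≠ 0)
    (hkk : ∀ j l, j ≠ l → P.k j + P.k l ≠ 0)
    (hkc : ∀ j l, P.k j ^ 2 ≠ (starRingEnd ℂ (P.k l)) ^ 2)
    (hpk : ∀ j, (P.p : ℂ) ^ 2 + P.k j ^ 2 ≠ 0)
    (hc : ∀ j l, P.coupling (P.k j) (starRingEnd ℂ (P.k l)) ≠ 0) :
    -- the tau functions are smooth and `f` is real
    (ContDiff ℝ ∞ (Function.uncurry P.f) ∧ ContDiff ℝ ∞ (Function.uncurry P.g₁) ∧
      ContDiff ℝ ∞ (Function.uncurry P.g₂) ∧ ∀ x t : ℝ, (P.f x t).im = 0) ∧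
    -- the bilinear equations
    (∀ x t : ℝ,
      ABSystem.hirota 1 1 P.g₁ P.f x t = (P.μ + P.lam) * P.g₁ x t * P.f x t ∧
      ABSystem.hirota 1 1 P.g₂ P.f x t = (P.μ + P.lam) * P.g₂ x t * P.f x t ∧
      ABSystem.hirota 2 0 P.f P.f x t + P.r ^ 2 * P.σ * (P.f x t * P.f x t) =
        P.σ * ((‖P.g₁ x t‖ : ℂ) ^ 2 + (‖P.g₂ x t‖ : ℂ) ^ 2)) ∧
    -- the canonical two-component AB system, where `f` does not vanish
    ABSystem.IsCanonicalSolutionOn P.μ P.σ P.A₁ P.A₂ P.B {q | P.f q.1 q.2 ≠ 0} ∧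
    -- the two-component AB system in the original coordinates
    (∀ c₁ c₂ n₁ n₂ : ℝ, c₁ ≠ c₂ → c₂ ≠ 0 → n₂ ≠ 0 →
      P.μ = n₁ * c₂ / (c₁ - c₂) ^ 2 → P.σ = n₂ / (c₁ - c₂) ^ 2 →
      ABSystem.IsSolutionOn c₁ c₂ n₁ n₂
        (fun X T => P.A₁ (X - c₁ * T) (T - X / c₂))
        (fun X T => P.A₂ (X - c₁ * T) (T - X / c₂))
        (fun X T => (c₁ - c₂) ^ 2 / (n₂ * c₂) * P.B (X - c₁ * T) (T - X / c₂))
        {q | P.f (q.1 - c₁ * q.2) (q.2 - q.1 / c₂) ≠ 0}) := by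
  have hP : P.Regular := ABSystem.Params.regular_of_ne hσ hp hk hkk hkc hpk hc
  have him (x t : ℝ) : (P.f x t).im = 0 := Complex.conj_eq_iff_im.mp (P.conj_f x t)
  have hbil := ABSystem.Params.bilinear_equations hP
  -- Reality of f lets it be replaced by its real part, the ρ of the lemmas on bilinear equations.
  have hf : P.f = fun x t => ((P.f x t).re : ℂ) := by
    funext x t
    exact Complex.ext rfl (him x t)
  have hρ : ContDiff ℝ ∞ (Function.uncurry fun x t => (P.f x t).re) :=
    Complex.reCLM.contDiff.comp P.contDiff_f
  have hcan : ABSystem.IsCanonicalSolutionOn P.μ P.σ P.A₁ P.A₂ P.B {q | P.f q.1 q.2 ≠ 0} := by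
    have h := ABSystem.isCanonicalSolutionOn_of_bilinear (r := P.r) (lam := P.lam) hρ P.contDiff_g₁
      P.contDiff_g₂ (fun x t => by rw [← hf, (hbil x t).1, ← congrFun (congrFun hf x) t])
      (fun x t => by rw [← hf, (hbil x t).2.1, ← congrFun (congrFun hf x) t])
      (fun x t => by rw [← hf, ← congrFun (congrFun hf x) t]; exact (hbil x t).2.2)
    simp only [← fun x t => congrFun (congrFun hf x) t] at h
    exact h
  exact ⟨⟨P.contDiff_f, P.contDiff_g₁, P.contDiff_g₂, him⟩, hbil, hcan,
    fun c₁ c₂ n₁ n₂ h₁ h₂ h₃ h₄ h₅ =>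
      ABSystem.isSolutionOn_of_isCanonicalSolutionOn hcan h₁ h₂ h₃ h₄ h₅⟩
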